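/- **Setting.** Let $(\mathcal S,\mathcal A,\mathcal B,H,\mathbb P,r)$ be a two-player zero-sum Markov game with finite action sets, horizon $H\ge 1$, transition kernels $\mathbb P_h(\cdot\mid x,a,b)$ and deterministic rewards $r_h(x,a,b)\in[0,1]$. The max-player uses policies $\pi=\{\pi_h(\cdot\mid x)\}$, the min-player $\nu=\{\nu_h(\cdot\mid x)\}$; $V_h^{\pi,\nu}(x)=\mathbb E_{\pi,\nu}[\sum_{h'=h}^H r_{h'}\mid x_h=x]$, $V_1^{*,\nu}=\sup_\pi V_1^{\pi,\nu}$, $V_1^{\pi,*}=\inf_\nu V_1^{\pi,\nu}$, $(\pi^*,\nu^*)$ is a Nash equilibrium (from every state, at every step), and $V_h^*=V_h^{\pi^*,\nu^*}$. The game is linear for a known feature map $\phi:\mathcal S\times\mathcal A\times\mathcal B\to\mathbb R^d$ with $\|\phi\|_2\le 1$: for each $h$ there are $\theta_h\in\mathbb R^d$ and a vector $\mu_h$ of $d$ signed measures on $\mathcal S$ with $\mathbb P_h(\cdot\mid x,a,b)=\langle\phi(x,a,b),\mu_h(\cdot)\rangle$, $r_h(x,a,b)=\langle\phi(x,a,b),\theta_h\rangle$,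 $\|\theta_h\|_2\le\sqrt d$ and $\|\mu_h(E)\|_2\le\sqrt d$ for all measurable $E\subseteq\mathcal S$. The dataset consists of $K\ge1$ independent trajectories of the game under a behavior policy $b$, from an initial distribution $\rho$. Let $\kappa=\min_h\lambda_{\min}\big(\mathbb E_b[\phi(x_h,a_h,b_h)\phi(x_h,a_h,b_h)^\top]\big)$. **SPMVI.** Split the trajectories, independently of the data, into $H$ folds $\mathcal D_1,\dots,\mathcal D_H$ of $K/H$ trajectories each. Put $\underline V_{H+1}=\overline V_{H+1}=0$ and, for $h=H,\dots,1$, with $\phi_h^\tau=\phi(x_h^\tau,a_h^\tau,b_h^\tau)$, $$\Lambda_h=\sum_{\tau\in\mathcal D_h}\phi_h^\tau(\phi_h^\tau)^\top+\lambda I,\quad \underline w_h=\Lambda_h^{-1}\sum_{\tau\in\mathcal D_h}\phi_h^\tau\big(r_h^\tau+\underline V_{h+1}(x_{h+1}^\tau)\big),\quad \overline w_h=\Lambda_h^{-1}\sum_{\tau\in\mathcal D_h}\phi_h^\tau\big(r_h^\tau+\overline V_{h+1}(x_{h+1}^\tau)\big),$$ $\Gamma_h=\beta\|\phi\|_{\Lambda_h^{-1}}$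 where $\|u\|_M=\sqrt{u^\top Mu}$, and let $\underline Q_h$, $\overline Q_h$ be $\phi^\top\underline w_h-\Gamma_h$ and $\phi^\top\overline w_h+\Gamma_h$ clipped to $[0,H-h+1]$. At each state $x$ let $(\widehat\pi_h,\nu_h')$ and $(\pi_h',\widehat\nu_h)$ be arbitrary Nash equilibria of the matrix games $\underline Q_h(x,\cdot,\cdot)$ and $\overline Q_h(x,\cdot,\cdot)$, and let $\underline V_h(x)$, $\overline V_h(x)$ be the corresponding equilibrium values. Output $(\widehat\pi,\widehat\nu)$. **Theorem.** There is an absolute constant $c_0>0$ such that for every $c\ge c_0$ there is a constant $C>0$, depending only on $c$, with the following property. For every game, feature map, behavior policy, initial distribution, equal splitting and Nash equilibrium $(\pi^*,\nu^*)$ as above and every $\delta\in(0,1)$, let $\iota=\log(2dHK/\delta)$ and run SPMVI with $\lambda=1$ and $\beta=c\sqrt d\,H\sqrt\iota$. Then with probability at least $1-\delta$, for all possible outcomes of the run (that is, all choices of the equilibria of the matrix games), the following two statements hold. 1. For all $x\in\mathcal S$, $$V_1^{*,\widehat\nu}(x)-V_1^{\widehat\pi,*}(x)\le C\sqrt d\,H\sqrt\iota\,\Big(\sup_\nu\sum_{h=1}^H\mathbb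 E_{\pi^*,\nu}\big[\|\phi(x_h,a_h,b_h)\|_{\Lambda_h^{-1}}\,\big|\,x_1=x\big]+\sup_\pi\sum_{h=1}^H\mathbb E_{\pi,\nu^*}\big[\|\phi(x_h,a_h,b_h)\|_{\Lambda_h^{-1}}\,\big|\,x_1=x\big]\Big),$$ where the expectations are over a fresh trajectory, for the given dataset. 2. If $\kappa>0$, then $$\sup_{h\in[H]}\|V_h^*-\overline V_h\|_\infty\le C\sqrt\iota\,\frac{H^{2.5}\sqrt d}{\sqrt{K\kappa}},\qquad \sup_{h\in[H]}\|V_h^*-\underline V_h\|_\infty\le C\sqrt\iota\,\frac{H^{2.5}\sqrt d}{\sqrt{K\kappa}}.$$ -/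

import Mathlib

open MeasureTheory ProbabilityTheory
open scoped BigOperators

noncomputable section

/-- A two-player zero-sum Markov game. Steps are numbered from `0`, so that step `h` here is step
`h + 1` in the usual numbering; in a game of horizon `H` only the steps `h < H` matter. -/
structure MarkovGame (S A B : Type*) [MeasurableSpace S] [MeasurableSpace A]
    [MeasurableSpace B] where
  /-- transition kernels -/
  P : ℕ → Kernel (S × A × B) S
  markov : ∀ h, IsMarkovKernel (P h)
  /-- deterministic rewards -/
  r : ℕ → S × A × B → ℝ
  measurable_r : ∀ h, Measurable (r h)
  r_mem : ∀ h z, r h z ∈ Set.Icc (0 : ℝ) 1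

instance {S A B : Type*} [MeasurableSpace S] [MeasurableSpace A] [MeasurableSpace B]
    (G : MarkovGame S A B) (h : ℕ) : IsMarkovKernel (G.P h) := G.markov h

/-- A Markov policy: at each step, a (measurable) map from states to distributions on actions. -/
structure Policy (S A : Type*) [MeasurableSpace S] [MeasurableSpace A] where
  kernel : ℕ → Kernel S A
  markov : ∀ h, IsMarkovKernel (kernel h)

instance {S A : Type*} [MeasurableSpace S] [MeasurableSpace A]
    (π : Policy S A) (h : ℕ) : IsMarkovKernel (π.kernel h) := π.markov h

/-- The probability `π_h(a | x)`. -/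
def Policy.prob {S A : Type*} [MeasurableSpace S] [MeasurableSpace A]
    (π : Policy S A) (h : ℕ) (x : S) (a : A) : ℝ := (π.kernel h x).real {a}

/-- The two players choose their actions independently given the state. -/
def Policy.joint {S A B : Type*} [MeasurableSpace S] [MeasurableSpace A] [MeasurableSpace B]
    (π : Policy S A) (ν : Policy S B) : Policy S (A × B) where
  kernel h := π.kernel h ×ₖ ν.kernel h
  markov _ := inferInstance

/-- A transition `((x_h, a_h, b_h), x_{h+1})`. -/
abbrev Transition (S A B : Type*) := (S × A × B) × S

/-- What the learner observes of a transition: `(x_h, a_h, b_h)`, the reward and `x_{h+1}`. -/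
structure Sample (S A B : Type*) where
  sa : S × A × B
  reward : ℝ
  next : S

section Game

variable {S A B : Type*} [MeasurableSpace S] [MeasurableSpace A] [MeasurableSpace B]

/-- Prepend the transition `((x, a, b), x')` to a trajectory. -/
def consTransition {n : ℕ} (q : S × (((A × B) × S) × (Fin n → Transition S A B))) :
    Fin (n + 1) → Transition S A B :=
  Fin.cons (α := fun _ => Transition S A B) ((q.1, q.2.1.1), q.2.1.2) q.2.2

theorem measurable_consTransition {n : ℕ} :
    Measurable (consTransition (S := S) (A := A) (B := B) (n := n)) := by
  refine measurable_pi_iff.mpr fun i => ?_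
  refine Fin.cases ?_ (fun j => ?_) i
  · simp only [consTransition, Fin.cons_zero]
    fun_prop
  · simp only [consTransition, Fin.cons_succ]
    fun_prop

/-- The law of the `n` transitions of steps `h, …, h + n - 1` when the state at step `h` is `x`,
the actions follow the joint policy `σ` and the states follow the kernels of the game. -/
def MarkovGame.traj (G : MarkovGame S A B) (σ : Policy S (A × B)) :
    (n : ℕ) → ℕ → Kernel S (Fin n → Transition S A B)
  | 0, _ => Kernel.const S (Measure.dirac Fin.elim0)
  | n + 1, h =>
      (Kernel.id ×ₖ ((σ.kernel h ⊗ₖ G.P h) ⊗ₖ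
        (G.traj σ n (h + 1)).comap (fun p : S × ((A × B) × S) => p.2.2)
          (measurable_snd.comp measurable_snd))).map consTransition

instance MarkovGame.isMarkovKernel_traj (G : MarkovGame S A B) (σ : Policy S (A × B)) (n h : ℕ) :
    IsMarkovKernel (G.traj σ n h) := by
  induction n generalizing h with
  | zero => unfold MarkovGame.traj; infer_instance
  | succ n ih =>
    unfold MarkovGame.traj
    have := ih (h + 1)
    exact Kernel.IsMarkovKernel.map _ measurable_consTransition

/-- The value function `V_h^{π,ν}(x)`: the expected sum of the rewards from step `h` on, given that
the state at step `h` is `x`. -/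
def MarkovGame.value (G : MarkovGame S A B) (H : ℕ) (π : Policy S A) (ν : Policy S B) (h : ℕ)
    (x : S) : ℝ :=
  ∫ ω, ∑ j : Fin (H - h), G.r (h + j) (ω j).1 ∂(G.traj (π.joint ν) (H - h) h x)

/-- `(π, ν)` is a Nash equilibrium: each policy is a best response to the other, from every state
and at every step. -/
def MarkovGame.IsNash (G : MarkovGame S A B) (H : ℕ) (π : Policy S A) (ν : Policy S B) : Prop :=
  ∀ h < H, ∀ x : S,
    (∀ π' : Policy S A, G.value H π' ν h x ≤ G.value H π ν h x) ∧
    (∀ ν' : Policy S B, G.value H π ν h x ≤ G.value H π ν' h x)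

/-- The duality gap `V_1^{*,ν}(x) - V_1^{π,*}(x)`. -/
def MarkovGame.gap (G : MarkovGame S A B) (H : ℕ) (π : Policy S A) (ν : Policy S B) (x : S) : ℝ :=
  (⨆ π' : Policy S A, G.value H π' ν 0 x) - (⨅ ν' : Policy S B, G.value H π ν' 0 x)

/-- The game of horizon `H` is linear in the feature map `φ`. The `d` signed measures of a step are
bundled into one vector measure with values in `ℝ^d`. -/
structure MarkovGame.IsLinear (G : MarkovGame S A B) (H : ℕ) {d : ℕ}
    (φ : S × A × B → EuclideanSpace ℝ (Fin d)) : Prop where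
  measurable : Measurable φ
  norm_le : ∀ z, ‖φ z‖ ≤ 1
  transition : ∀ h < H, ∃ μ : VectorMeasure S (EuclideanSpace ℝ (Fin d)),
    (∀ z E, MeasurableSet E → (G.P h z).real E = inner ℝ (φ z) (μ E)) ∧
    (∀ E, MeasurableSet E → ‖μ E‖ ≤ √d)
  reward : ∀ h < H, ∃ θ : EuclideanSpace ℝ (Fin d),
    (∀ z, G.r h z = inner ℝ (φ z) θ) ∧ ‖θ‖ ≤ √d

/-- The law of one trajectory of length `H` with initial distribution `ρ` and behavior policy
`b`. -/
def MarkovGame.trajLaw (G : MarkovGame S A B) (ρ : Measure S) (b : Policy S (A × B)) (H : ℕ) :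
    Measure (Fin H → Transition S A B) :=
  ρ.bind (G.traj b H 0)

/-- The law of `K` independent trajectories. -/
def MarkovGame.dataLaw (G : MarkovGame S A B) (ρ : Measure S) (b : Policy S (A × B)) (H K : ℕ) :
    Measure (Fin K → Fin H → Transition S A B) :=
  Measure.pi fun _ => G.trajLaw ρ b H

/-- The dataset seen by the learner, with its rewards. -/
def MarkovGame.observe (G : MarkovGame S A B) {H K : ℕ} (ω : Fin K → Fin H → Transition S A B) :
    Fin K → Fin H → Sample S A B :=
  fun τ h => ⟨(ω τ h).1, G.r h (ω τ h).1, (ω τ h).2⟩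

/-- The covariance matrix `𝔼[φ(x_h, a_h, b_h) φ(x_h, a_h, b_h)ᵀ]` under the behavior policy. -/
def MarkovGame.featureCov (G : MarkovGame S A B) (ρ : Measure S) (b : Policy S (A × B)) {H d : ℕ}
    (φ : S × A × B → EuclideanSpace ℝ (Fin d)) (h : Fin H) : Matrix (Fin d) (Fin d) ℝ :=
  Matrix.of fun i j => ∫ ω, φ (ω h).1 i * φ (ω h).1 j ∂(G.trajLaw ρ b H)

/-- The smallest (real) eigenvalue of a matrix. -/
def minEigenvalue {d : ℕ} (M : Matrix (Fin d) (Fin d) ℝ) : ℝ := sInf (spectrum ℝ M)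

/-- The coverage coefficient `κ = min_h λ_min(𝔼[φ φᵀ])`. -/
def MarkovGame.coverage (G : MarkovGame S A B) (ρ : Measure S) (b : Policy S (A × B)) (H : ℕ)
    {d : ℕ} (φ : S × A × B → EuclideanSpace ℝ (Fin d)) : ℝ :=
  ⨅ h : Fin H, minEigenvalue (G.featureCov ρ b φ h)

end Game

/-- The norm `‖u‖_M = √(uᵀ M u)`. -/
def matNorm {d : ℕ} (M : Matrix (Fin d) (Fin d) ℝ) (u : EuclideanSpace ℝ (Fin d)) : ℝ :=
  √(u.ofLp ⬝ᵥ M.mulVec u.ofLp)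

/-- The expected payoff of the matrix game `Q` under the mixed strategies `p` and `q`. -/
def payoff {A B : Type*} [Fintype A] [Fintype B] (Q : A → B → ℝ) (p : A → ℝ) (q : B → ℝ) : ℝ :=
  ∑ a, ∑ b, p a * q b * Q a b

/-- `(p, q)` is a Nash equilibrium of the zero-sum matrix game in which the first player maximizes
and the second one minimizes the payoff `Q`. -/
def IsMatrixNash {A B : Type*} [Fintype A] [Fintype B] (Q : A → B → ℝ) (p : A → ℝ) (q : B → ℝ) :
    Prop :=
  p ∈ stdSimplex ℝ A ∧ q ∈ stdSimplex ℝ B ∧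
    (∀ p' ∈ stdSimplex ℝ A, payoff Q p' q ≤ payoff Q p q) ∧
    (∀ q' ∈ stdSimplex ℝ B, payoff Q p q ≤ payoff Q p q')

section Algorithm

variable {S A B : Type*} {H K d : ℕ}

/-- The regularized Gram matrix `Λ_h`, built from the trajectories of the `h`-th fold only;
`fold τ` is the fold that trajectory `τ` is put in. -/
def gram (φ : S × A × B → EuclideanSpace ℝ (Fin d)) (fold : Fin K → Fin H) (lam : ℝ)
    (D : Fin K → Fin H → Sample S A B) (h : Fin H) : Matrix (Fin d) (Fin d) ℝ :=
  (∑ τ with fold τ = h, Matrix.vecMulVec (φ (D τ h).sa).ofLp (φ (D τ h).sa).ofLp) +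
    lam • (1 : Matrix (Fin d) (Fin d) ℝ)

/-- The ridge regression weights `Λ_h⁻¹ ∑_{τ ∈ D_h} φ_h^τ (r_h^τ + V(x_{h+1}^τ))`. -/
def ridge (φ : S × A × B → EuclideanSpace ℝ (Fin d)) (fold : Fin K → Fin H) (lam : ℝ)
    (D : Fin K → Fin H → Sample S A B) (h : Fin H) (V : S → ℝ) : Fin d → ℝ :=
  (gram φ fold lam D h)⁻¹.mulVec
    (∑ τ with fold τ = h, ((D τ h).reward + V (D τ h).next) • (φ (D τ h).sa).ofLp)

/-- The bonus `Γ_h = β ‖φ‖_{Λ_h⁻¹}`. -/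
def bonus (φ : S × A × B → EuclideanSpace ℝ (Fin d)) (fold : Fin K → Fin H) (lam β : ℝ)
    (D : Fin K → Fin H → Sample S A B) (h : Fin H) (z : S × A × B) : ℝ :=
  β * matNorm (gram φ fold lam D h)⁻¹ (φ z)

/-- The lower estimate of the Q-function at step `h`, given the estimate `V` of the value function
at the next step, clipped to `[0, H - h]` (`H - h` rewards remain as steps start at `0`). -/
def lowerQ (φ : S × A × B → EuclideanSpace ℝ (Fin d)) (fold : Fin K → Fin H) (lam β : ℝ)
    (D : Fin K → Fin H → Sample S A B) (h : Fin H) (V : S → ℝ) (z : S × A × B) : ℝ :=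
  max 0 (min ((φ z).ofLp ⬝ᵥ ridge φ fold lam D h V - bonus φ fold lam β D h z) ((H : ℝ) - h))

/-- The upper estimate of the Q-function. -/
def upperQ (φ : S × A × B → EuclideanSpace ℝ (Fin d)) (fold : Fin K → Fin H) (lam β : ℝ)
    (D : Fin K → Fin H → Sample S A B) (h : Fin H) (V : S → ℝ) (z : S × A × B) : ℝ :=
  max 0 (min ((φ z).ofLp ⬝ᵥ ridge φ fold lam D h V + bonus φ fold lam β D h z) ((H : ℝ) - h))

end Algorithm

/-- All that a run of SPMVI computes: the output pair `(πHat, νHat)`, the other halves `νAux`,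
`πAux` of the two equilibria, and the lower and upper estimates of the value functions. -/
structure SPMVIRun (S A B : Type*) [MeasurableSpace S] [MeasurableSpace A]
    [MeasurableSpace B] where
  πHat : Policy S A
  νAux : Policy S B
  πAux : Policy S A
  νHat : Policy S B
  loV : ℕ → S → ℝ
  upV : ℕ → S → ℝ

/-- `R` is a run of SPMVI on the dataset `D`, with the folds `fold`, ridge parameter `lam` and bonus
multiplier `β`; the equilibria of the matrix games may be any. -/
structure SPMVIRun.IsRunOn {S A B : Type*} [MeasurableSpace S] [MeasurableSpace A]
    [MeasurableSpace B] [Fintype A] [Fintype B] {H K d : ℕ} (R : SPMVIRun S A B)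
    (φ : S × A × B → EuclideanSpace ℝ (Fin d)) (fold : Fin K → Fin H) (lam β : ℝ)
    (D : Fin K → Fin H → Sample S A B) : Prop where
  loV_last : ∀ x, R.loV H x = 0
  upV_last : ∀ x, R.upV H x = 0
  lower_nash : ∀ (h : Fin H) (x : S),
    IsMatrixNash (fun a b => lowerQ φ fold lam β D h (R.loV (h + 1)) (x, a, b))
      (R.πHat.prob h x) (R.νAux.prob h x)
  upper_nash : ∀ (h : Fin H) (x : S),
    IsMatrixNash (fun a b => upperQ φ fold lam β D h (R.upV (h + 1)) (x, a, b))
      (R.πAux.prob h x) (R.νHat.prob h x)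
  loV_eq : ∀ (h : Fin H) (x : S), R.loV h x =
    payoff (fun a b => lowerQ φ fold lam β D h (R.loV (h + 1)) (x, a, b))
      (R.πHat.prob h x) (R.νAux.prob h x)
  upV_eq : ∀ (h : Fin H) (x : S), R.upV h x =
    payoff (fun a b => upperQ φ fold lam β D h (R.upV (h + 1)) (x, a, b))
      (R.πAux.prob h x) (R.νHat.prob h x)

/-- `∑_h 𝔼_{π,ν}[‖φ(x_h, a_h, b_h)‖_{Λ_h⁻¹} | x_1 = x]`. -/
def MarkovGame.uncertainty {S A B : Type*} [MeasurableSpace S] [MeasurableSpace A]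
    [MeasurableSpace B] (G : MarkovGame S A B) {H d : ℕ}
    (φ : S × A × B → EuclideanSpace ℝ (Fin d)) (Λ : Fin H → Matrix (Fin d) (Fin d) ℝ)
    (π : Policy S A) (ν : Policy S B) (x : S) : ℝ :=
  ∑ h : Fin H, ∫ ω, matNorm (Λ h)⁻¹ (φ (ω h).1) ∂(G.traj (π.joint ν) H 0 x)

/-- The common logarithm `log (2 d H K / δ)` behind the `Õ`-notation. -/
def logFactor (d H K : ℕ) (δ : ℝ) : ℝ := Real.log (2 * d * H * K / δ)

end

/-! All equilibria of a matrix game have the same value, so the value estimates of a run of SPMVI do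
not depend on the chosen equilibria. The estimate `V` of step `h + 1` is hence a measurable function
of the folds of the later steps and independent of fold `h`: given the states and actions of fold
`h`, the regression noise is a sum of independent centered bounded terms, and Hoeffding's inequality
in the `d` whitened coordinates bounds it in the norm of `Λ_h⁻¹`, without a covering of the class of
possible `V`. As the game is linear, the Bellman backup of `V` is linear in `φ`, so with high
probability every ridge regression is accurate up to its bonus.

On this event the bonus makes `upV` an upper bound for the values of the game against `νHat`, and
`loV` a lower bound for those against `πHat`. By backward induction the distance of `upV` and `loV`
from the Nash value is at most twice the expected sum of the bonuses along the plays of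
`(πAux, νStar)` and of `(πStar, νAux)`, respectively, which gives the first claim.

For the second claim, let `n = K / H`. A lower Chernoff bound at every point of a finite grid of
directions gives `Λ_h ≥ (n κ / 32) I` with high probability if `n κ` is large compared with `d ι`.
Otherwise the claimed rate exceeds `H`, which bounds the distance of any two values. -/

noncomputable section

section MatrixGames

variable {A B : Type*} [Fintype A] [Fintype B] {Q Q' : A → B → ℝ} {p : A → ℝ} {q : B → ℝ}

theorem payoff_mono (hp : p ∈ stdSimplex ℝ A) (hq : q ∈ stdSimplex ℝ B)
    (h : ∀ a b, Q a b ≤ Q' a b) : payoff Q p q ≤ payoff Q' p q :=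
  Finset.sum_le_sum fun a _ => Finset.sum_le_sum fun b _ =>
    mul_le_mul_of_nonneg_left (h a b) (mul_nonneg (hp.1 a) (hq.1 b))

theorem payoff_const (hp : p ∈ stdSimplex ℝ A) (hq : q ∈ stdSimplex ℝ B) (t : ℝ) :
    payoff (fun _ _ => t) p q = t := by
  simp only [payoff, ← Finset.sum_mul, ← Finset.mul_sum, hq.2, mul_one, hp.2, one_mul]

theorem payoff_add (Q Q' : A → B → ℝ) (p : A → ℝ) (q : B → ℝ) :
    payoff (fun a b => Q a b + Q' a b) p q = payoff Q p q + payoff Q' p q := by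
  simp only [payoff, mul_add, Finset.sum_add_distrib]

theorem payoff_mem_Icc (hp : p ∈ stdSimplex ℝ A) (hq : q ∈ stdSimplex ℝ B) {l u : ℝ}
    (h : ∀ a b, Q a b ∈ Set.Icc l u) : payoff Q p q ∈ Set.Icc l u :=
  ⟨(payoff_const hp hq l).ge.trans (payoff_mono hp hq fun a b => (h a b).1),
    (payoff_mono hp hq fun a b => (h a b).2).trans (payoff_const hp hq u).le⟩

theorem payoff_mem_Icc_norm (Q : A → B → ℝ) (hp : p ∈ stdSimplex ℝ A) (hq : q ∈ stdSimplex ℝ B) :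
    payoff Q p q ∈ Set.Icc (-‖Q‖) ‖Q‖ :=
  payoff_mem_Icc hp hq fun a b =>
    abs_le.mp ((norm_le_pi_norm (Q a) b).trans (norm_le_pi_norm Q a))

/-- The (lower) value `max_p min_q` of the zero-sum matrix game `Q`. -/
def matrixGameValue (Q : A → B → ℝ) : ℝ :=
  ⨆ p : stdSimplex ℝ A, ⨅ q : stdSimplex ℝ B, payoff Q p.1 q.1

theorem bddBelow_range_payoff (Q : A → B → ℝ) (hp : p ∈ stdSimplex ℝ A) :
    BddBelow (Set.range fun q : stdSimplex ℝ B => payoff Q p q.1) :=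
  ⟨-‖Q‖, Set.forall_mem_range.mpr fun q => (payoff_mem_Icc_norm Q hp q.2).1⟩

theorem bddAbove_range_iInf_payoff (Q : A → B → ℝ) (hq : q ∈ stdSimplex ℝ B) :
    BddAbove (Set.range fun p : stdSimplex ℝ A => ⨅ q : stdSimplex ℝ B, payoff Q p.1 q.1) :=
  ⟨‖Q‖, Set.forall_mem_range.mpr fun p =>
    (ciInf_le (bddBelow_range_payoff Q p.2) ⟨q, hq⟩).trans (payoff_mem_Icc_norm Q p.2 hq).2⟩

theorem matrixGameValue_mem_Icc {u : ℝ} (hu : 0 ≤ u) (h : ∀ a b, Q a b ∈ Set.Icc 0 u) :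
    matrixGameValue Q ∈ Set.Icc 0 u := by
  refine ⟨Real.iSup_nonneg fun p => Real.iInf_nonneg fun q => (payoff_mem_Icc p.2 q.2 h).1,
    Real.iSup_le (fun p => ?_) hu⟩
  cases isEmpty_or_nonempty (stdSimplex ℝ B) with
  | inl _ => rwa [Real.iInf_of_isEmpty]
  | inr hB =>
    obtain ⟨q⟩ := hB
    exact (ciInf_le (bddBelow_range_payoff Q p.2) q).trans (payoff_mem_Icc p.2 q.2 h).2

theorem IsMatrixNash.payoff_eq (h : IsMatrixNash Q p q) : payoff Q p q = matrixGameValue Q := by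
  obtain ⟨hp, hq, hmax, hmin⟩ := h
  have : Nonempty (stdSimplex ℝ A) := ⟨⟨p, hp⟩⟩
  have : Nonempty (stdSimplex ℝ B) := ⟨⟨q, hq⟩⟩
  refine le_antisymm ?_ (ciSup_le fun p' => ?_)
  · exact (le_ciInf fun q' : stdSimplex ℝ B => hmin q' q'.2).trans
      (le_ciSup (bddAbove_range_iInf_payoff Q hq) ⟨p, hp⟩)
  · exact (ciInf_le (bddBelow_range_payoff Q p'.2) ⟨q, hq⟩).trans (hmax p' p'.2)

theorem payoff_le_payoff_add_dist (Q Q' : A → B → ℝ) (hp : p ∈ stdSimplex ℝ A)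
    (hq : q ∈ stdSimplex ℝ B) : payoff Q p q ≤ payoff Q' p q + dist Q Q' := by
  rw [← payoff_const hp hq (dist Q Q'), ← payoff_add]
  refine payoff_mono hp hq fun a b => ?_
  have hab : dist (Q a b) (Q' a b) ≤ dist Q Q' :=
    (dist_le_pi_dist (Q a) (Q' a) b).trans (dist_le_pi_dist Q Q' a)
  rw [Real.dist_eq] at hab
  linarith [le_abs_self (Q a b - Q' a b)]

theorem lipschitzWith_matrixGameValue :
    LipschitzWith 1 (matrixGameValue : (A → B → ℝ) → ℝ) := by
  rcases isEmpty_or_nonempty A with _ | _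
  · exact LipschitzWith.of_dist_le_mul fun Q Q' => by simp [Subsingleton.elim Q Q']
  rcases isEmpty_or_nonempty B with _ | _
  · exact LipschitzWith.of_dist_le_mul fun Q Q' => by simp [Subsingleton.elim Q Q']
  obtain ⟨q₀⟩ : Nonempty (stdSimplex ℝ B) := inferInstance
  refine LipschitzWith.of_le_add fun Q Q' => ciSup_le fun p => ?_
  rw [← sub_le_iff_le_add]
  refine le_trans (le_ciInf fun q => ?_) (le_ciSup (bddAbove_range_iInf_payoff Q' q₀.2) p)
  rw [sub_le_iff_le_add]
  exact (ciInf_le (bddBelow_range_payoff Q p.2) q).trans (payoff_le_payoff_add_dist Q Q' p.2 q.2)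

end MatrixGames

section Trajectories

variable {S A B : Type*} [MeasurableSpace S] [MeasurableSpace A] [MeasurableSpace B]

theorem Policy.prob_mem_stdSimplex [Fintype A] [MeasurableSingletonClass A] (π : Policy S A)
    (h : ℕ) (x : S) : π.prob h x ∈ stdSimplex ℝ A := by
  refine ⟨fun a => measureReal_nonneg, ?_⟩
  simp only [Policy.prob, sum_measureReal_singleton, Finset.coe_univ, probReal_univ]

theorem Policy.integral_joint [Fintype A] [MeasurableSingletonClass A] [Fintype B]
    [MeasurableSingletonClass B] (π : Policy S A) (ν : Policy S B) (h : ℕ) (x : S)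
    (F : A × B → ℝ) :
    ∫ c, F c ∂((π.joint ν).kernel h x) =
      payoff (fun a b => F (a, b)) (π.prob h x) (ν.prob h x) := by
  rw [integral_fintype .of_finite, Fintype.sum_prod_type]
  simp only [payoff, Policy.joint, Policy.prob, Kernel.prod_apply, smul_eq_mul]
  refine Finset.sum_congr rfl fun a _ => Finset.sum_congr rfl fun b _ => ?_
  rw [← Set.singleton_prod_singleton, measureReal_prod_prod]

theorem measurable_consTransition_left {n : ℕ} (x : S) :
    Measurable fun q => consTransition (A := A) (B := B) (n := n) (x, q) :=
  measurable_consTransition.comp measurable_prodMk_left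

theorem MarkovGame.traj_succ_apply (G : MarkovGame S A B) (σ : Policy S (A × B)) (n h : ℕ)
    (x : S) :
    G.traj σ (n + 1) h x =
      (((σ.kernel h ⊗ₖ G.P h) ⊗ₖ (G.traj σ n (h + 1)).comap
        (fun p : S × ((A × B) × S) => p.2.2) (measurable_snd.comp measurable_snd)) x).map
          fun q => consTransition (x, q) := by
  rw [MarkovGame.traj, Kernel.map_apply _ measurable_consTransition, Kernel.prod_apply,
    Kernel.id_apply, Measure.dirac_prod,
    Measure.map_map measurable_consTransition measurable_prodMk_left]
  rfl

theorem MarkovGame.lintegral_traj_succ (G : MarkovGame S A B) (σ : Policy S (A × B)) (n h : ℕ)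
    (x : S) {f : (Fin (n + 1) → Transition S A B) → ENNReal} (hf : Measurable f) :
    ∫⁻ ω, f ω ∂(G.traj σ (n + 1) h x) =
      ∫⁻ c, ∫⁻ y, ∫⁻ ω, f (consTransition (x, ((c, y), ω))) ∂(G.traj σ n (h + 1) y)
        ∂(G.P h (x, c)) ∂(σ.kernel h x) := by
  have hfx : Measurable fun q => f (consTransition (x, q)) :=
    hf.comp (measurable_consTransition_left x)
  rw [G.traj_succ_apply, lintegral_map hf (measurable_consTransition_left x),
    Kernel.lintegral_compProd _ _ _ hfx, Kernel.lintegral_compProd]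
  · simp only [Kernel.comap_apply]
  · exact Measurable.lintegral_kernel_prod_right' (κ := ((G.traj σ n (h + 1)).comap
      (fun p : S × ((A × B) × S) => p.2.2) (measurable_snd.comp measurable_snd)).comap
        (Prod.mk x) measurable_prodMk_left) hfx

theorem MarkovGame.integral_traj_succ (G : MarkovGame S A B) (σ : Policy S (A × B)) (n h : ℕ)
    (x : S) {f : (Fin (n + 1) → Transition S A B) → ℝ}
    (hf : Integrable f (G.traj σ (n + 1) h x)) :
    ∫ ω, f ω ∂(G.traj σ (n + 1) h x) =
      ∫ c, ∫ y, ∫ ω, f (consTransition (x, ((c, y), ω))) ∂(G.traj σ n (h + 1) y)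
        ∂(G.P h (x, c)) ∂(σ.kernel h x) := by
  have hcons := measurable_consTransition_left (A := A) (B := B) (n := n) x
  rw [G.traj_succ_apply] at hf ⊢
  have hfx := (integrable_map_measure hf.aestronglyMeasurable hcons.aemeasurable).mp hf
  rw [integral_map hcons.aemeasurable hf.aestronglyMeasurable]
  exact (ProbabilityTheory.integral_compProd hfx).trans
    (ProbabilityTheory.integral_compProd hfx.integral_compProd)

theorem MarkovGame.lintegral_traj_eval (G : MarkovGame S A B) (σ : Policy S (A × B)) (n h : ℕ)
    (x : S) (j : Fin n) {f : Transition S A B → ENNReal} (hf : Measurable f) :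
    ∫⁻ ω, f (ω j) ∂(G.traj σ n h x) =
      ∫⁻ ω, ∫⁻ y, f ((ω j).1, y) ∂(G.P (h + j) (ω j).1) ∂(G.traj σ n h x) := by
  induction n generalizing h x with
  | zero => exact j.elim0
  | succ n ih =>
    have hint : Measurable fun z : S × A × B => ∫⁻ y, f (z, y) ∂(G.P (h + j) z) :=
      hf.lintegral_kernel_prod_right'
    rw [G.lintegral_traj_succ σ n h x (f := fun ω => f (ω j)) (hf.comp (measurable_pi_apply j)),
      G.lintegral_traj_succ σ n h x
        (f := fun ω => ∫⁻ y, f ((ω j).1, y) ∂(G.P (h + j) (ω j).1))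
        (hint.comp (measurable_fst.comp (measurable_pi_apply j)))]
    refine Fin.cases ?_ (fun i => ?_) j
    · simp [consTransition]
    · have hstep : h + (i.succ : ℕ) = (h + 1) + i := by rw [Fin.val_succ]; omega
      simp only [consTransition, Fin.cons_succ, hstep, ← ih (h + 1) _ i]

instance MarkovGame.isProbabilityMeasure_trajLaw (G : MarkovGame S A B) (ρ : Measure S)
    [IsProbabilityMeasure ρ] (b : Policy S (A × B)) (H : ℕ) :
    IsProbabilityMeasure (G.trajLaw ρ b H) := by
  unfold MarkovGame.trajLaw; infer_instance

theorem MarkovGame.map_eval_trajLaw (G : MarkovGame S A B) (ρ : Measure S)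
    [IsProbabilityMeasure ρ] (b : Policy S (A × B)) {H : ℕ} (h : Fin H) :
    (G.trajLaw ρ b H).map (fun ω => ω h) =
      ((G.trajLaw ρ b H).map fun ω => (ω h).1) ⊗ₘ G.P h := by
  have heval : Measurable fun ω : Fin H → Transition S A B => ω h := measurable_pi_apply h
  have hfst : Measurable fun ω : Fin H → Transition S A B => (ω h).1 := measurable_fst.comp heval
  have : IsProbabilityMeasure ((G.trajLaw ρ b H).map fun ω => (ω h).1) :=
    Measure.isProbabilityMeasure_map hfst.aemeasurable
  refine Measure.ext_of_lintegral _ fun f hf => ?_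
  have hint : Measurable fun z : S × A × B => ∫⁻ y, f (z, y) ∂(G.P h z) :=
    hf.lintegral_kernel_prod_right'
  rw [lintegral_map hf heval, Measure.lintegral_compProd hf, lintegral_map hint hfst,
    MarkovGame.trajLaw,
    Measure.lintegral_bind (μ := G.traj b H 0) (f := fun ω => f (ω h)) (Kernel.aemeasurable _)
      (hf.comp heval).aemeasurable,
    Measure.lintegral_bind (μ := G.traj b H 0)
      (f := fun ω => ∫⁻ y, f ((ω h).1, y) ∂(G.P h (ω h).1)) (Kernel.aemeasurable _)
      (hint.comp hfst).aemeasurable]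
  refine lintegral_congr fun x => ?_
  simpa using G.lintegral_traj_eval b H 0 x h hf

end Trajectories

section ExpectedSums

variable {S A B : Type*} {g : ℕ → S × A × B → ℝ} {M : ℝ}

/-- The sum of the functions `g h, …, g (h + n - 1)` along the `n` transitions `ω` of the steps
`h, …, h + n - 1`. -/
def stepSum (g : ℕ → S × A × B → ℝ) {n : ℕ} (h : ℕ) (ω : Fin n → Transition S A B) : ℝ :=
  ∑ j : Fin n, g (h + j) (ω j).1

theorem abs_stepSum_le (hM : ∀ h z, |g h z| ≤ M) {n : ℕ} (h : ℕ) (ω : Fin n → Transition S A B) :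
    |stepSum g h ω| ≤ n * M := by
  calc |stepSum g h ω| ≤ ∑ j : Fin n, |g (h + j) (ω j).1| := Finset.abs_sum_le_sum_abs _ _
    _ ≤ ∑ _j : Fin n, M := Finset.sum_le_sum fun j _ => hM _ _
    _ = n * M := by simp

theorem stepSum_consTransition (g : ℕ → S × A × B → ℝ) {n : ℕ} (h : ℕ) (x y : S) (c : A × B)
    (ω : Fin n → Transition S A B) :
    stepSum g h (consTransition (x, ((c, y), ω))) = g h (x, c) + stepSum g (h + 1) ω := by
  have hstep : ∀ i : Fin n, h + (i.succ : ℕ) = (h + 1) + i := fun i => by rw [Fin.val_succ]; omega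
  simp only [stepSum, Fin.sum_univ_succ, consTransition, Fin.cons_zero, Fin.cons_succ, hstep,
    Fin.val_zero, add_zero]

variable [MeasurableSpace S] [MeasurableSpace A] [MeasurableSpace B]

theorem measurable_stepSum (hg : ∀ h, Measurable (g h)) (n h : ℕ) :
    Measurable (stepSum g h : (Fin n → Transition S A B) → ℝ) :=
  Finset.measurable_sum _ fun j _ => (hg _).comp (measurable_fst.comp (measurable_pi_apply j))

namespace MarkovGame

theorem integrable_stepSum (G : MarkovGame S A B) (σ : Policy S (A × B))
    (hg : ∀ h, Measurable (g h)) (hM : ∀ h z, |g h z| ≤ M) (n h k : ℕ) (x : S) :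
    Integrable (stepSum g k) (G.traj σ n h x) :=
  Integrable.of_bound (measurable_stepSum hg n k).aestronglyMeasurable (n * M)
    (ae_of_all _ (abs_stepSum_le hM k))

/-- The expected sum of `g` over the `n` steps that start at step `h` in state `x`. -/
def expectedSum (G : MarkovGame S A B) (σ : Policy S (A × B)) (g : ℕ → S × A × B → ℝ)
    (n h : ℕ) (x : S) : ℝ :=
  ∫ ω, stepSum g h ω ∂(G.traj σ n h x)

theorem measurable_expectedSum (G : MarkovGame S A B) (σ : Policy S (A × B))
    (hg : ∀ h, Measurable (g h)) (n h : ℕ) : Measurable (G.expectedSum σ g n h) :=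
  ((measurable_stepSum hg n h).stronglyMeasurable.integral_kernel (κ := G.traj σ n h)).measurable

theorem expectedSum_zero (G : MarkovGame S A B) (σ : Policy S (A × B)) (g : ℕ → S × A × B → ℝ)
    (h : ℕ) (x : S) : G.expectedSum σ g 0 h x = 0 := by
  simp [expectedSum, stepSum]

theorem abs_expectedSum_le (G : MarkovGame S A B) (σ : Policy S (A × B))
    (hM : ∀ h z, |g h z| ≤ M) (n h : ℕ) (x : S) : |G.expectedSum σ g n h x| ≤ n * M := by
  simpa [expectedSum] using norm_integral_le_of_norm_le_const (μ := G.traj σ n h x)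
    (f := stepSum g h) (ae_of_all _ (abs_stepSum_le hM h))

theorem expectedSum_nonneg (G : MarkovGame S A B) (σ : Policy S (A × B))
    (hg : ∀ h z, 0 ≤ g h z) (n h : ℕ) (x : S) : 0 ≤ G.expectedSum σ g n h x :=
  integral_nonneg fun _ => Finset.sum_nonneg fun _ _ => hg _ _

theorem integrable_expectedSum (G : MarkovGame S A B) (σ : Policy S (A × B))
    (hg : ∀ h, Measurable (g h)) (hM : ∀ h z, |g h z| ≤ M) (n h : ℕ) (μ : Measure S)
    [IsFiniteMeasure μ] : Integrable (G.expectedSum σ g n h) μ :=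
  Integrable.of_bound (G.measurable_expectedSum σ hg n h).aestronglyMeasurable (n * M)
    (ae_of_all _ (G.abs_expectedSum_le σ hM n h))

theorem expectedSum_succ (G : MarkovGame S A B) (σ : Policy S (A × B))
    (hg : ∀ h, Measurable (g h)) (hM : ∀ h z, |g h z| ≤ M) (n h : ℕ) (x : S) :
    G.expectedSum σ g (n + 1) h x =
      ∫ c, (g h (x, c) + ∫ y, G.expectedSum σ g n (h + 1) y ∂(G.P h (x, c)))
        ∂(σ.kernel h x) := by
  rw [expectedSum, G.integral_traj_succ σ n h x (G.integrable_stepSum σ hg hM (n + 1) h h x)]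
  refine integral_congr_ae (ae_of_all _ fun c => ?_)
  have hinner : ∀ y, ∫ ω, stepSum g h (consTransition (x, ((c, y), ω)))
      ∂(G.traj σ n (h + 1) y) = g h (x, c) + G.expectedSum σ g n (h + 1) y := fun y => by
    simp only [stepSum_consTransition]
    rw [integral_add (integrable_const _) (G.integrable_stepSum σ hg hM n (h + 1) (h + 1) y)]
    simp [expectedSum]
  simp only [hinner]
  rw [integral_add (integrable_const _) (G.integrable_expectedSum σ hg hM n (h + 1) _)]
  simp

end MarkovGame

end ExpectedSums

section LinearExpectations

variable {S Z E : Type*} [MeasurableSpace S] [NormedAddCommGroup E] [InnerProductSpace ℝ E]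
  [FiniteDimensional ℝ E] {V : S → ℝ}

theorem measurable_signedMeasure_superlevel (ν : SignedMeasure S) (hV : Measurable V) :
    Measurable fun t => ν {x | t ≤ V x} := by
  have hanti (m : Measure S) [IsFiniteMeasure m] : Antitone fun t => m.real {x | t ≤ V x} :=
    fun t u htu => measureReal_mono fun x hx => htu.trans hx
  have hjordan : ∀ t, ν {x | t ≤ V x} =
      ν.toJordanDecomposition.posPart.real {x | t ≤ V x} -
        ν.toJordanDecomposition.negPart.real {x | t ≤ V x} := fun t => by
    conv_lhs => rw [← ν.toSignedMeasure_toJordanDecomposition]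
    exact Measure.toSignedMeasure_sub_apply (measurableSet_le measurable_const hV)
  simp only [hjordan]
  exact (hanti _).measurable.sub (hanti _).measurable

theorem stronglyMeasurable_vectorMeasure_superlevel (μ : VectorMeasure S E) (hV : Measurable V) :
    StronglyMeasurable fun t => μ {x | t ≤ V x} := by
  set e := stdOrthonormalBasis ℝ E
  have hcoord : ∀ i, Measurable fun t => inner ℝ (e i) (μ {x | t ≤ V x}) := fun i =>
    measurable_signedMeasure_superlevel
      (μ.mapRange (innerSL ℝ (e i)).toLinearMap.toAddMonoidHom (innerSL ℝ (e i)).continuous) hV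
  have hsum : (fun t => μ {x | t ≤ V x}) =
      fun t => ∑ i, inner ℝ (e i) (μ {x | t ≤ V x}) • e i :=
    funext fun t => (e.sum_repr' _).symm
  rw [hsum]
  exact Finset.stronglyMeasurable_fun_sum _ fun i _ =>
    (hcoord i).stronglyMeasurable.smul_const (e i)

theorem exists_integral_eq_inner_of_linear (P : Z → Measure S) [∀ z, IsFiniteMeasure (P z)]
    (φ : Z → E) (μ : VectorMeasure S E)
    (hμ : ∀ z F, MeasurableSet F → (P z).real F = inner ℝ (φ z) (μ F))
    {r : ℝ} (hr : ∀ F, MeasurableSet F → ‖μ F‖ ≤ r) (hVm : Measurable V) {M : ℝ} (hM : 0 ≤ M)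
    (hV : ∀ x, V x ∈ Set.Icc 0 M) :
    ∃ w : E, ‖w‖ ≤ r * M ∧ ∀ z, ∫ x, V x ∂(P z) = inner ℝ (φ z) w := by
  have hlevel : ∀ t, MeasurableSet {x | t ≤ V x} := fun t => measurableSet_le measurable_const hVm
  have hint : Integrable (fun t => μ {x | t ≤ V x}) (volume.restrict (Set.Ioc 0 M)) :=
    Integrable.of_bound (stronglyMeasurable_vectorMeasure_superlevel μ hVm).aestronglyMeasurable r
      (ae_of_all _ fun t => hr _ (hlevel t))
  refine ⟨∫ t in Set.Ioc 0 M, μ {x | t ≤ V x}, ?_, fun z => ?_⟩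
  · refine (norm_integral_le_of_norm_le_const (ae_of_all _ fun t => hr _ (hlevel t))).trans ?_
    simp [hM]
  · have hVint : Integrable V (P z) := Integrable.of_mem_Icc 0 M hVm.aemeasurable (ae_of_all _ hV)
    rw [hVint.integral_eq_integral_Ioc_meas_le (ae_of_all _ fun x => (hV x).1)
      (ae_of_all _ fun x => (hV x).2), ← integral_inner hint]
    simp only [hμ z _ (hlevel _)]

end LinearExpectations

section ProductMeasures

variable {ι : Type*} {X Z S : ι → Type*} [∀ i, MeasurableSpace (X i)]
  [∀ i, MeasurableSpace (Z i)] [∀ i, MeasurableSpace (S i)]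

theorem measurable_pi_ite (p : ι → Prop) [DecidablePred p] :
    Measurable fun (q : (∀ i, X i) × (∀ i, X i)) (i : ι) => if p i then q.2 i else q.1 i := by
  refine measurable_pi_iff.mpr fun i => ?_
  by_cases hp : p i <;> simp only [hp, if_true, if_false] <;> fun_prop

variable [Fintype ι]

theorem lintegral_pi_prod (μ : ∀ i, Measure (X i)) [∀ i, IsProbabilityMeasure (μ i)]
    {f : ∀ i, X i → ENNReal} (hf : ∀ i, Measurable (f i)) (s : Finset ι) :
    ∫⁻ ω, ∏ i ∈ s, f i (ω i) ∂(Measure.pi μ) = ∏ i ∈ s, ∫⁻ x, f i x ∂(μ i) := by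
  rw [lintegral_prod_eq_prod_lintegral_of_indepFun s (fun i (ω : ∀ i, X i) => f i (ω i))
    (iIndepFun_pi fun i => (hf i).aemeasurable) fun i => (hf i).comp (measurable_pi_apply i)]
  exact Finset.prod_congr rfl fun i _ => (measurePreserving_eval μ i).lintegral_comp (hf i)

/-- The product of the kernels `P i`, each applied to its own coordinate. -/
def piKernel (P : ∀ i, Kernel (Z i) (S i)) [∀ i, IsMarkovKernel (P i)] :
    Kernel (∀ i, Z i) (∀ i, S i) where
  toFun z := Measure.pi fun i => P i (z i)
  measurable' := by
    refine Measurable.measure_of_isPiSystem_of_isProbabilityMeasure generateFrom_pi.symm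
      isPiSystem_pi ?_
    rintro _ ⟨t, ht, rfl⟩
    simp only [Measure.pi_pi]
    exact Finset.measurable_prod _ fun i _ =>
      ((P i).measurable_coe (ht i trivial)).comp (measurable_pi_apply i)

theorem piKernel_apply (P : ∀ i, Kernel (Z i) (S i)) [∀ i, IsMarkovKernel (P i)] (z : ∀ i, Z i) :
    piKernel P z = Measure.pi fun i => P i (z i) := rfl

instance (P : ∀ i, Kernel (Z i) (S i)) [∀ i, IsMarkovKernel (P i)] : IsMarkovKernel (piKernel P) :=
  ⟨fun z => by rw [piKernel_apply]; infer_instance⟩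

theorem pi_compProd (m : ∀ i, Measure (Z i)) [∀ i, IsProbabilityMeasure (m i)]
    (P : ∀ i, Kernel (Z i) (S i)) [∀ i, IsMarkovKernel (P i)] :
    Measure.pi (fun i => m i ⊗ₘ P i) =
      (Measure.pi m ⊗ₘ piKernel P).map fun q i => (q.1 i, q.2 i) := by
  have hzip : Measurable fun (q : (∀ i, Z i) × (∀ i, S i)) (i : ι) => (q.1 i, q.2 i) := by fun_prop
  refine Measure.pi_eq fun s hs => ?_
  have hslice : ∀ z : ∀ i, Z i, piKernel P z
      (Prod.mk z ⁻¹' ((fun (q : (∀ i, Z i) × (∀ i, S i)) i => (q.1 i, q.2 i)) ⁻¹'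
        Set.univ.pi s)) = ∏ i, P i (z i) (Prod.mk (z i) ⁻¹' s i) := fun z => by
    rw [piKernel_apply, ← Measure.pi_pi]
    rfl
  rw [Measure.map_apply hzip (.univ_pi hs), Measure.compProd_apply (hzip (.univ_pi hs))]
  simp only [hslice]
  rw [lintegral_pi_prod m (f := fun i z => P i z (Prod.mk z ⁻¹' s i))
    fun i => Kernel.measurable_kernel_prodMk_left (hs i)]
  exact Finset.prod_congr rfl fun i _ => (Measure.compProd_apply (hs i)).symm

theorem pi_compProd_le_of_forall (m : ∀ i, Measure (Z i)) [∀ i, IsProbabilityMeasure (m i)]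
    (P : ∀ i, Kernel (Z i) (S i)) [∀ i, IsMarkovKernel (P i)] {E : Set (∀ i, Z i × S i)}
    (hE : MeasurableSet E) {ε : ENNReal}
    (h : ∀ z : ∀ i, Z i,
      Measure.pi (fun i => P i (z i)) {x | (fun i => (z i, x i)) ∈ E} ≤ ε) :
    Measure.pi (fun i => m i ⊗ₘ P i) E ≤ ε := by
  have hzip : Measurable fun (q : (∀ i, Z i) × (∀ i, S i)) (i : ι) => (q.1 i, q.2 i) := by fun_prop
  rw [pi_compProd, Measure.map_apply hzip hE, Measure.compProd_apply (hzip hE)]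
  calc _ ≤ ∫⁻ _, ε ∂(Measure.pi m) := lintegral_mono fun z => h z
    _ = ε := by simp

theorem pi_eq_map_ite_prod (μ : ∀ i, Measure (X i)) [∀ i, IsProbabilityMeasure (μ i)]
    (p : ι → Prop) [DecidablePred p] :
    Measure.pi μ =
      ((Measure.pi μ).prod (Measure.pi μ)).map fun q i => if p i then q.2 i else q.1 i := by
  refine Measure.pi_eq fun s hs => ?_
  have hpre : (fun (q : (∀ i, X i) × (∀ i, X i)) (i : ι) => if p i then q.2 i else q.1 i) ⁻¹'
      Set.univ.pi s = (Set.univ.pi fun i => if p i then Set.univ else s i) ×ˢ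
        (Set.univ.pi fun i => if p i then s i else Set.univ) := by
    ext q
    simp only [Set.mem_preimage, Set.mem_pi, Set.mem_prod, Set.mem_univ, true_imp_iff,
      ← forall_and]
    refine forall_congr' fun i => ?_
    by_cases hp : p i <;> simp [hp]
  rw [Measure.map_apply (measurable_pi_ite p) (.univ_pi hs), hpre, Measure.prod_prod,
    Measure.pi_pi, Measure.pi_pi, ← Finset.prod_mul_distrib]
  refine Finset.prod_congr rfl fun i _ => ?_
  by_cases hp : p i <;> simp [hp]

theorem pi_le_of_forall_ite (μ : ∀ i, Measure (X i)) [∀ i, IsProbabilityMeasure (μ i)]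
    (p : ι → Prop) [DecidablePred p] {E : Set (∀ i, X i)} (hE : MeasurableSet E) {ε : ENNReal}
    (h : ∀ y : ∀ i, X i, Measure.pi μ {ω | (fun i => if p i then ω i else y i) ∈ E} ≤ ε) :
    Measure.pi μ E ≤ ε := by
  rw [pi_eq_map_ite_prod μ p, Measure.map_apply (measurable_pi_ite p) hE,
    Measure.prod_apply (measurable_pi_ite p hE)]
  calc _ ≤ ∫⁻ _, ε ∂(Measure.pi μ) := lintegral_mono fun y => h y
    _ = ε := by simp

end ProductMeasures

section RidgeRegression

open Matrix
open scoped MatrixOrder Matrix.Norms.L2Operator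

variable {d : ℕ} {ι : Type*}

theorem norm_toLp_sq (v : Fin d → ℝ) : ‖WithLp.toLp 2 v‖ ^ 2 = v ⬝ᵥ v := by
  rw [EuclideanSpace.real_norm_sq_eq]
  simp [dotProduct, sq]

theorem inner_eq_dotProduct (u v : EuclideanSpace ℝ (Fin d)) :
    inner ℝ u v = u.ofLp ⬝ᵥ v.ofLp := by
  rw [EuclideanSpace.inner_eq_star_dotProduct, star_trivial, dotProduct_comm]

theorem matNorm_nonneg (M : Matrix (Fin d) (Fin d) ℝ) (u : EuclideanSpace ℝ (Fin d)) :
    0 ≤ matNorm M u := Real.sqrt_nonneg _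

theorem exists_inv_eq_transpose_mul_self {L : Matrix (Fin d) (Fin d) ℝ} (hL : L.PosDef) :
    ∃ N : Matrix (Fin d) (Fin d) ℝ, L⁻¹ = Nᵀ * N ∧ N * L * Nᵀ = 1 := by
  obtain ⟨N, hN⟩ := CStarAlgebra.nonneg_iff_eq_star_mul_self.mp hL.inv.posSemidef.nonneg
  rw [star_eq_conjTranspose, conjTranspose_eq_transpose_of_trivial] at hN
  refine ⟨N, hN, mul_eq_one_comm.mp ?_⟩
  rw [← mul_assoc, ← hN, nonsing_inv_mul _ ((isUnit_iff_isUnit_det L).mp hL.isUnit)]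

theorem matNorm_transpose_mul_self (N : Matrix (Fin d) (Fin d) ℝ)
    (u : EuclideanSpace ℝ (Fin d)) :
    matNorm (Nᵀ * N) u = ‖WithLp.toLp 2 (N *ᵥ u.ofLp)‖ := by
  rw [matNorm, ← mulVec_mulVec, dotProduct_mulVec, vecMul_transpose, ← norm_toLp_sq,
    Real.sqrt_sq (norm_nonneg _)]

theorem matNorm_inv_sub_le {L : Matrix (Fin d) (Fin d) ℝ} (hL : L.PosDef)
    (u v : EuclideanSpace ℝ (Fin d)) :
    matNorm L⁻¹ (u - v) ≤ matNorm L⁻¹ u + matNorm L⁻¹ v := by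
  obtain ⟨N, hN, -⟩ := exists_inv_eq_transpose_mul_self hL
  simp only [hN, matNorm_transpose_mul_self, WithLp.ofLp_sub, mulVec_sub, WithLp.toLp_sub]
  exact norm_sub_le _ _

theorem abs_dotProduct_inv_mulVec_le {L : Matrix (Fin d) (Fin d) ℝ} (hL : L.PosDef)
    (u v : EuclideanSpace ℝ (Fin d)) :
    |u.ofLp ⬝ᵥ L⁻¹ *ᵥ v.ofLp| ≤ matNorm L⁻¹ u * matNorm L⁻¹ v := by
  obtain ⟨N, hN, -⟩ := exists_inv_eq_transpose_mul_self hL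
  rw [hN, matNorm_transpose_mul_self, matNorm_transpose_mul_self, ← mulVec_mulVec,
    dotProduct_mulVec, vecMul_transpose]
  have hcs := abs_real_inner_le_norm (WithLp.toLp 2 (N *ᵥ u.ofLp)) (WithLp.toLp 2 (N *ᵥ v.ofLp))
  rwa [inner_eq_dotProduct] at hcs

theorem matNorm_inv_le {L : Matrix (Fin d) (Fin d) ℝ} (hL : L.PosDef) {α : ℝ} (hα : 0 < α)
    (h : ∀ v, α * (v ⬝ᵥ v) ≤ v ⬝ᵥ L *ᵥ v) (u : EuclideanSpace ℝ (Fin d)) :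
    matNorm L⁻¹ u ≤ ‖u‖ / √α := by
  set w : EuclideanSpace ℝ (Fin d) := WithLp.toLp 2 (L⁻¹ *ᵥ u.ofLp) with hw
  have hLw : L *ᵥ w.ofLp = u.ofLp := by
    rw [hw, mulVec_mulVec, mul_nonsing_inv _ ((isUnit_iff_isUnit_det L).mp hL.isUnit), one_mulVec]
  have hlower : α * ‖w‖ ^ 2 ≤ inner ℝ u w := by
    have := h w.ofLp
    rwa [hLw, ← norm_toLp_sq, dotProduct_comm, ← inner_eq_dotProduct] at this
  have hnorm : √α * ‖w‖ ≤ ‖u‖ / √α := by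
    rw [le_div_iff₀ (Real.sqrt_pos.mpr hα), mul_right_comm, Real.mul_self_sqrt hα.le]
    rcases (norm_nonneg w).eq_or_lt with h0 | h0
    · simp [← h0]
    · refine le_of_mul_le_mul_right ?_ h0
      linarith [hlower.trans (real_inner_le_norm u w)]
  have hmat : matNorm L⁻¹ u ^ 2 = inner ℝ u w := by
    rw [inner_eq_dotProduct, matNorm, Real.sq_sqrt]
    rw [← inner_eq_dotProduct u w]
    exact (by positivity : 0 ≤ α * ‖w‖ ^ 2).trans hlower
  refine abs_le_of_sq_le_sq' ?_ (by positivity) |>.2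
  calc matNorm L⁻¹ u ^ 2 ≤ ‖u‖ * ‖w‖ := hmat ▸ real_inner_le_norm u w
    _ = ‖u‖ / √α * (√α * ‖w‖) := by field_simp
    _ ≤ ‖u‖ / √α * (‖u‖ / √α) := by gcongr
    _ = _ := (sq _).symm

/-- The regularized Gram matrix of the vectors `f τ`, `τ ∈ s`. -/
def regGram (lam : ℝ) (s : Finset ι) (f : ι → EuclideanSpace ℝ (Fin d)) :
    Matrix (Fin d) (Fin d) ℝ :=
  ∑ τ ∈ s, vecMulVec (f τ).ofLp (f τ).ofLp + lam • (1 : Matrix (Fin d) (Fin d) ℝ)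

variable (lam : ℝ) (s : Finset ι) (f : ι → EuclideanSpace ℝ (Fin d))

theorem regGram_mulVec (v : Fin d → ℝ) :
    regGram lam s f *ᵥ v = ∑ τ ∈ s, ((f τ).ofLp ⬝ᵥ v) • (f τ).ofLp + lam • v := by
  simp [regGram, add_mulVec, sum_mulVec, vecMulVec_mulVec, smul_mulVec]

theorem dotProduct_regGram_mulVec (v : Fin d → ℝ) :
    v ⬝ᵥ regGram lam s f *ᵥ v = ∑ τ ∈ s, ((f τ).ofLp ⬝ᵥ v) ^ 2 + lam * (v ⬝ᵥ v) := by
  rw [regGram_mulVec, dotProduct_add, dotProduct_sum, dotProduct_smul, smul_eq_mul]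
  simp only [dotProduct_comm v, smul_dotProduct, smul_eq_mul, sq]

theorem sum_sq_le_dotProduct_regGram_mulVec {lam : ℝ} (hlam : 0 ≤ lam) (v : Fin d → ℝ) :
    ∑ τ ∈ s, ((f τ).ofLp ⬝ᵥ v) ^ 2 ≤ v ⬝ᵥ regGram lam s f *ᵥ v := by
  rw [dotProduct_regGram_mulVec, ← norm_toLp_sq]
  exact le_add_of_nonneg_right (by positivity)

theorem mul_dotProduct_le_regGram (v : Fin d → ℝ) :
    lam * (v ⬝ᵥ v) ≤ v ⬝ᵥ regGram lam s f *ᵥ v := by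
  rw [dotProduct_regGram_mulVec]
  exact le_add_of_nonneg_left (Finset.sum_nonneg fun _ _ => sq_nonneg _)

variable {lam}

theorem posDef_regGram (hlam : 0 < lam) : (regGram lam s f).PosDef := by
  refine PosDef.posSemidef_add (posSemidef_sum s fun τ _ => ?_) (PosDef.one.smul hlam)
  simpa using posSemidef_vecMulVec_self_star (R := ℝ) (f τ).ofLp

theorem matNorm_regGram_inv_le (hlam : 0 < lam) (u : EuclideanSpace ℝ (Fin d)) :
    matNorm (regGram lam s f)⁻¹ u ≤ ‖u‖ / √lam :=
  matNorm_inv_le (posDef_regGram s f hlam) hlam (mul_dotProduct_le_regGram lam s f) u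

theorem abs_ridge_sub_le (hlam : 0 < lam) {y e : ι → ℝ} {w : EuclideanSpace ℝ (Fin d)}
    (hy : ∀ τ ∈ s, y τ = inner ℝ (f τ) w + e τ) (u : EuclideanSpace ℝ (Fin d)) :
    |u.ofLp ⬝ᵥ ((regGram lam s f)⁻¹ *ᵥ ∑ τ ∈ s, y τ • (f τ).ofLp) - inner ℝ u w| ≤
      matNorm (regGram lam s f)⁻¹ u *
        (matNorm (regGram lam s f)⁻¹ (∑ τ ∈ s, e τ • f τ) + √lam * ‖w‖) := by
  have hL := posDef_regGram s f hlam
  have hnormal : ∑ τ ∈ s, y τ • (f τ).ofLp =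
      regGram lam s f *ᵥ w.ofLp + (∑ τ ∈ s, e τ • f τ - lam • w).ofLp := by
    rw [regGram_mulVec, Finset.sum_congr rfl fun τ hτ => by rw [hy τ hτ, add_smul],
      Finset.sum_add_distrib]
    simp only [WithLp.ofLp_sub, WithLp.ofLp_sum, WithLp.ofLp_smul, inner_eq_dotProduct]
    abel
  have hbias : matNorm (regGram lam s f)⁻¹ (lam • w) ≤ √lam * ‖w‖ := by
    refine (matNorm_regGram_inv_le s f hlam _).trans_eq ?_
    rw [norm_smul, Real.norm_of_nonneg hlam.le, mul_div_right_comm, Real.div_sqrt]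
  rw [hnormal, mulVec_add, mulVec_mulVec,
    nonsing_inv_mul _ ((isUnit_iff_isUnit_det _).mp hL.isUnit), one_mulVec, dotProduct_add,
    inner_eq_dotProduct, add_sub_cancel_left]
  calc _ ≤ _ := abs_dotProduct_inv_mulVec_le hL _ _
    _ ≤ _ := by
      gcongr
      · exact matNorm_nonneg _ _
      · exact (matNorm_inv_sub_le hL _ _).trans (by gcongr)

end RidgeRegression

section SelfNormalizedNoise

open Matrix

variable {Ω ι : Type*} [MeasurableSpace Ω] {μ : Measure Ω}

theorem hasSubgaussianMGF_of_le {X : Ω → ℝ} {c c' : NNReal} (h : HasSubgaussianMGF X c μ)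
    (hc : c ≤ c') : HasSubgaussianMGF X c' μ :=
  ⟨h.integrable_exp_mul, fun t => (h.mgf_le t).trans (by gcongr)⟩

theorem measure_le_abs_of_hasSubgaussianMGF [IsFiniteMeasure μ] {X : Ω → ℝ} {c : NNReal}
    (h : HasSubgaussianMGF X c μ) {t : ℝ} (ht : 0 ≤ t) :
    μ {ω | t ≤ |X ω|} ≤ ENNReal.ofReal (2 * Real.exp (-t ^ 2 / (2 * c))) := by
  have hsub : {ω | t ≤ |X ω|} ⊆ {ω | t ≤ X ω} ∪ {ω | t ≤ (-X) ω} := fun ω hω =>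
    (le_abs.mp hω : t ≤ X ω ∨ t ≤ -X ω)
  calc μ {ω | t ≤ |X ω|} ≤ μ {ω | t ≤ X ω} + μ {ω | t ≤ (-X) ω} :=
        (measure_mono hsub).trans (measure_union_le _ _)
    _ ≤ ENNReal.ofReal (Real.exp (-t ^ 2 / (2 * c))) +
          ENNReal.ofReal (Real.exp (-t ^ 2 / (2 * c))) := by
        rw [← ofReal_measureReal, ← ofReal_measureReal]
        gcongr
        exacts [h.measure_ge_le ht, h.neg.measure_ge_le ht]
    _ = _ := by
        rw [two_mul (Real.exp _), ENNReal.ofReal_add (Real.exp_pos _).le (Real.exp_pos _).le]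

theorem measure_le_abs_weighted_sum_le [IsProbabilityMeasure μ] {X : ι → Ω → ℝ}
    (hX : ∀ i, Measurable (X i)) (hind : iIndepFun X μ) {l u : ℝ}
    (hmem : ∀ i ω, X i ω ∈ Set.Icc l u) (s : Finset ι) {a : ι → ℝ} (ha : ∑ i ∈ s, a i ^ 2 ≤ 1)
    {t : ℝ} (ht : 0 ≤ t) :
    μ {ω | t ≤ |∑ i ∈ s, a i * (X i ω - μ[X i])|} ≤
      ENNReal.ofReal (2 * Real.exp (-(2 * t ^ 2 / (u - l) ^ 2))) := by
  have hterm : ∀ i, HasSubgaussianMGF (fun ω => a i * (X i ω - μ[X i]))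
      ((a i ^ 2).toNNReal * (‖u - l‖₊ / 2) ^ 2) μ := fun i => by
    rw [Real.toNNReal_of_nonneg (sq_nonneg _)]
    exact (hasSubgaussianMGF_of_mem_Icc (hX i).aemeasurable (ae_of_all _ (hmem i))).const_mul (a i)
  have hind' : iIndepFun (fun i ω => a i * (X i ω - μ[X i])) μ :=
    hind.comp (fun i (x : ℝ) => a i * (x - ∫ ω, X i ω ∂μ)) fun i => by fun_prop
  have hsum : HasSubgaussianMGF (fun ω => ∑ i ∈ s, a i * (X i ω - μ[X i]))
      ((‖u - l‖₊ / 2) ^ 2) μ := by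
    refine hasSubgaussianMGF_of_le
      (HasSubgaussianMGF.sum_of_iIndepFun hind' fun i _ => hterm i) ?_
    rw [← Finset.sum_mul, ← Real.toNNReal_sum_of_nonneg fun i _ => sq_nonneg _]
    exact mul_le_of_le_one_left (by positivity) (Real.toNNReal_le_one.mpr ha)
  convert measure_le_abs_of_hasSubgaussianMGF hsum ht using 4
  simp only [NNReal.coe_pow, NNReal.coe_div, coe_nnnorm, Real.norm_eq_abs, div_pow, sq_abs,
    NNReal.coe_ofNat, neg_div]
  congr 1
  rcases eq_or_ne (u - l) 0 with h0 | h0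
  · simp [h0]
  · field_simp

variable {d : ℕ}

theorem sum_sq_mulVec_le_one {lam : ℝ} (hlam : 0 ≤ lam) (s : Finset ι)
    (f : ι → EuclideanSpace ℝ (Fin d)) {N : Matrix (Fin d) (Fin d) ℝ}
    (hN : N * regGram lam s f * Nᵀ = 1) (i : Fin d) :
    ∑ τ ∈ s, (N *ᵥ (f τ).ofLp) i ^ 2 ≤ 1 := by
  have hdiag : N i ⬝ᵥ regGram lam s f *ᵥ N i = 1 := by
    rw [dotProduct_mulVec]
    exact congrFun (congrFun hN i) i |>.trans (one_apply_eq i)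
  rw [← hdiag]
  refine le_of_eq_of_le ?_ (sum_sq_le_dotProduct_regGram_mulVec s f hlam (N i))
  simp only [mulVec, dotProduct_comm (N i)]

theorem norm_toLp_le_of_forall_abs_le {v : Fin d → ℝ} {t : ℝ} (ht : 0 ≤ t)
    (h : ∀ i, |v i| ≤ t) : ‖WithLp.toLp 2 v‖ ≤ √d * t := by
  refine abs_le_of_sq_le_sq' ?_ (by positivity) |>.2
  rw [mul_pow, Real.sq_sqrt (Nat.cast_nonneg _), EuclideanSpace.real_norm_sq_eq]
  calc ∑ i, v i ^ 2 ≤ ∑ _i : Fin d, t ^ 2 :=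
        Finset.sum_le_sum fun i _ => sq_le_sq' (abs_le.mp (h i)).1 (abs_le.mp (h i)).2
    _ = d * t ^ 2 := by simp

theorem measure_matNorm_noise_le [IsProbabilityMeasure μ] {X : ι → Ω → ℝ}
    (hX : ∀ i, Measurable (X i)) (hind : iIndepFun X μ) {l u : ℝ}
    (hmem : ∀ i ω, X i ω ∈ Set.Icc l u) {lam : ℝ} (hlam : 0 < lam) (s : Finset ι)
    (f : ι → EuclideanSpace ℝ (Fin d)) {t : ℝ} (ht : 0 ≤ t) :
    μ {ω | √d * t < matNorm (regGram lam s f)⁻¹ (∑ τ ∈ s, (X τ ω - μ[X τ]) • f τ)} ≤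
      ENNReal.ofReal (d * (2 * Real.exp (-(2 * t ^ 2 / (u - l) ^ 2)))) := by
  obtain ⟨N, hN, hN1⟩ := exists_inv_eq_transpose_mul_self (posDef_regGram s f hlam)
  have hcoord : ∀ ω i, (N *ᵥ (∑ τ ∈ s, (X τ ω - μ[X τ]) • f τ).ofLp) i =
      ∑ τ ∈ s, (N *ᵥ (f τ).ofLp) i * (X τ ω - μ[X τ]) := fun ω i => by
    simp [mulVec_sum, mulVec_smul, mul_comm]
  have hsub : {ω | √d * t < matNorm (regGram lam s f)⁻¹ (∑ τ ∈ s, (X τ ω - μ[X τ]) • f τ)} ⊆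
      ⋃ i : Fin d, {ω | t ≤ |∑ τ ∈ s, (N *ᵥ (f τ).ofLp) i * (X τ ω - μ[X τ])|} := by
    intro ω hω
    by_contra hcon
    simp only [Set.mem_iUnion, Set.mem_ofPred_eq, not_exists, not_le] at hcon
    rw [Set.mem_ofPred_eq] at hω
    refine absurd hω (not_lt.mpr ?_)
    rw [hN, matNorm_transpose_mul_self]
    exact norm_toLp_le_of_forall_abs_le ht fun i => (hcoord ω i ▸ hcon i).le
  calc _ ≤ ∑ i : Fin d, μ {ω | t ≤ |∑ τ ∈ s, (N *ᵥ (f τ).ofLp) i * (X τ ω - μ[X τ])|} :=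
        (measure_mono hsub).trans (measure_iUnion_fintype_le _ _)
    _ ≤ ∑ _i : Fin d, ENNReal.ofReal (2 * Real.exp (-(2 * t ^ 2 / (u - l) ^ 2))) :=
        Finset.sum_le_sum fun i _ => measure_le_abs_weighted_sum_le hX hind hmem s
          (sum_sq_mulVec_le_one hlam.le s f hN1 i) ht
    _ = _ := by simp [ENNReal.ofReal_mul]

end SelfNormalizedNoise

section Measurability

open Matrix

variable {d : ℕ} {ι Ω : Type*} [MeasurableSpace Ω]

theorem measurable_matrix_inv_apply {M : Ω → Matrix (Fin d) (Fin d) ℝ}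
    (hM : ∀ i j, Measurable fun ω => M ω i j) (i j : Fin d) :
    Measurable fun ω => (M ω)⁻¹ i j := by
  have hentries : Measurable fun ω i j => M ω i j :=
    measurable_pi_iff.mpr fun i => measurable_pi_iff.mpr fun j => hM i j
  have hof : Continuous fun f : Fin d → Fin d → ℝ => Matrix.of f :=
    continuous_matrix fun i j => by fun_prop
  simp only [Matrix.inv_def, Matrix.smul_apply, Ring.inverse_eq_inv', smul_eq_mul]
  exact (hof.matrix_det.measurable.comp hentries).inv.mul
    ((hof.matrix_adjugate.matrix_elem i j).measurable.comp hentries)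

theorem measurable_regGram_inv_apply (lam : ℝ) (s : Finset ι)
    {f : ι → Ω → EuclideanSpace ℝ (Fin d)} (hf : ∀ τ, Measurable (f τ)) (i j : Fin d) :
    Measurable fun ω => (regGram lam s fun τ => f τ ω)⁻¹ i j := by
  refine measurable_matrix_inv_apply (fun i j => ?_) i j
  simp only [regGram, Matrix.add_apply, Matrix.sum_apply, vecMulVec_apply]
  fun_prop

theorem measurable_dotProduct_mulVec {M : Ω → Matrix (Fin d) (Fin d) ℝ}
    (hM : ∀ i j, Measurable fun ω => M ω i j) {u v : Ω → Fin d → ℝ} (hu : Measurable u)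
    (hv : Measurable v) : Measurable fun ω => u ω ⬝ᵥ M ω *ᵥ v ω := by
  simp only [dotProduct, mulVec]
  fun_prop

theorem measurable_matNorm_regGram_inv (lam : ℝ) (s : Finset ι)
    {f : ι → Ω → EuclideanSpace ℝ (Fin d)} (hf : ∀ τ, Measurable (f τ))
    {u : Ω → EuclideanSpace ℝ (Fin d)} (hu : Measurable u) :
    Measurable fun ω => matNorm (regGram lam s fun τ => f τ ω)⁻¹ (u ω) :=
  (measurable_dotProduct_mulVec (measurable_regGram_inv_apply lam s hf) (by fun_prop)
    (by fun_prop)).sqrt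

end Measurability

section ValueEstimates

open Matrix hiding gram

variable {S A B : Type*} {H K d : ℕ} (φ : S × A × B → EuclideanSpace ℝ (Fin d))
  (fold : Fin K → Fin H) (lam β : ℝ)

theorem lowerQ_eq_upperQ_neg (D : Fin K → Fin H → Sample S A B) (h : Fin H) (V : S → ℝ) :
    lowerQ φ fold lam β D h V = upperQ φ fold lam (-β) D h V := by
  funext z
  simp [lowerQ, upperQ, bonus, sub_eq_add_neg]

theorem upperQ_mem_Icc (D : Fin K → Fin H → Sample S A B) (h : Fin H) (V : S → ℝ)
    (z : S × A × B) : upperQ φ fold lam β D h V z ∈ Set.Icc 0 ((H : ℝ) - h) :=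
  ⟨le_max_left _ _, max_le (sub_nonneg.mpr (by exact_mod_cast h.2.le)) (min_le_right _ _)⟩

variable {fold} {D D' : Fin K → Fin H → Sample S A B} {h : Fin H}

theorem gram_congr (hD : ∀ τ, fold τ = h → D τ = D' τ) :
    gram φ fold lam D h = gram φ fold lam D' h := by
  rw [gram, gram]
  congr 1
  exact Finset.sum_congr rfl fun τ hτ => by rw [hD τ (Finset.mem_filter.mp hτ).2]

theorem upperQ_congr (hD : ∀ τ, fold τ = h → D τ = D' τ) (V : S → ℝ) :
    upperQ φ fold lam β D h V = upperQ φ fold lam β D' h V := by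
  have hridge : ridge φ fold lam D h V = ridge φ fold lam D' h V := by
    rw [ridge, ridge, gram_congr φ lam hD]
    congr 1
    exact Finset.sum_congr rfl fun τ hτ => by rw [hD τ (Finset.mem_filter.mp hτ).2]
  funext z
  simp only [upperQ, bonus, hridge, gram_congr φ lam hD]

variable (fold) (D)

/-- The value estimates of SPMVI with the signed bonus multiplier `β`: the upper estimates for
`β ≥ 0`, and the lower ones for `-β`. They do not depend on the choice of the equilibria, as all
equilibria of a matrix game have the same value. -/
def valueEstimate [Fintype A] [Fintype B] (h : ℕ) (x : S) : ℝ :=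
  if hh : h < H then
    matrixGameValue fun a b =>
      upperQ φ fold lam β D ⟨h, hh⟩ (valueEstimate (h + 1)) (x, a, b)
  else 0
  termination_by H - h

variable [Fintype A] [Fintype B]

theorem valueEstimate_last : valueEstimate φ fold lam β D H = 0 := by
  funext x
  rw [valueEstimate, dif_neg (lt_irrefl H), Pi.zero_apply]

theorem valueEstimate_of_lt (h : Fin H) : valueEstimate φ fold lam β D h = fun x =>
    matrixGameValue fun a b =>
      upperQ φ fold lam β D h (valueEstimate φ fold lam β D (h + 1)) (x, a, b) := by
  funext x
  rw [valueEstimate, dif_pos h.2]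

theorem valueEstimate_mem_Icc {h : ℕ} (hh : h ≤ H) (x : S) :
    valueEstimate φ fold lam β D h x ∈ Set.Icc 0 ((H : ℝ) - h) := by
  rcases hh.eq_or_lt with rfl | hlt
  · simp [valueEstimate_last]
  · rw [valueEstimate_of_lt φ fold lam β D ⟨h, hlt⟩]
    exact matrixGameValue_mem_Icc (sub_nonneg.mpr (by exact_mod_cast hh))
      fun a b => upperQ_mem_Icc φ fold lam β D ⟨h, hlt⟩ _ _

variable {fold D}

theorem valueEstimate_congr {h : ℕ} (hh : h ≤ H)
    (hD : ∀ τ, h ≤ fold τ → D τ = D' τ) :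
    valueEstimate φ fold lam β D h = valueEstimate φ fold lam β D' h := by
  induction hh using Nat.decreasingInduction with
  | self => rw [valueEstimate_last, valueEstimate_last]
  | of_succ h hh ih =>
    rw [valueEstimate_of_lt φ fold lam β D ⟨h, hh⟩, valueEstimate_of_lt φ fold lam β D' ⟨h, hh⟩,
      ih fun τ hτ => hD τ (by omega), upperQ_congr φ lam β fun τ hτ => hD τ (by rw [hτ])]

end ValueEstimates

section Runs

open Matrix hiding gram

variable {S A B : Type*} [MeasurableSpace S] [MeasurableSpace A] [MeasurableSpace B]
  {H K d : ℕ} {φ : S × A × B → EuclideanSpace ℝ (Fin d)}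

theorem measurable_upperQ (G : MarkovGame S A B) (hφ : Measurable φ) (fold : Fin K → Fin H)
    (lam β : ℝ) (h : Fin H) {V : (Fin K → Fin H → Transition S A B) → S → ℝ}
    (hV : Measurable (Function.uncurry V)) (a : A) (b : B) :
    Measurable fun q : (Fin K → Fin H → Transition S A B) × S =>
      upperQ φ fold lam β (G.observe q.1) h (V q.1) (q.2, a, b) := by
  have hφτ : ∀ τ, Measurable fun q : (Fin K → Fin H → Transition S A B) × S =>
      φ (q.1 τ h).1 := fun τ => by fun_prop
  have hu : Measurable fun q : (Fin K → Fin H → Transition S A B) × S => φ (q.2, a, b) := by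
    fun_prop
  have hV' : ∀ τ, Measurable fun q : (Fin K → Fin H → Transition S A B) × S =>
      V q.1 (q.1 τ h).2 := fun τ =>
    hV.comp (f := fun q : (Fin K → Fin H → Transition S A B) × S => (q.1, (q.1 τ h).2))
      (by fun_prop)
  have hr : ∀ τ, Measurable fun q : (Fin K → Fin H → Transition S A B) × S =>
      G.r h (q.1 τ h).1 := fun τ => (G.measurable_r h).comp (by fun_prop)
  refine measurable_const.max (Measurable.min (Measurable.add ?_ ?_) measurable_const)
  · refine measurable_dotProduct_mulVec (measurable_regGram_inv_apply lam _ hφτ) (by fun_prop)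
      (Finset.measurable_sum _ fun τ _ => ?_)
    exact ((hr τ).add (hV' τ)).smul (by fun_prop)
  · exact measurable_const.mul (measurable_matNorm_regGram_inv lam _ hφτ hu)

variable [Fintype A] [Fintype B] {fold : Fin K → Fin H} {lam β : ℝ}
  {D : Fin K → Fin H → Sample S A B} {R : SPMVIRun S A B}

theorem SPMVIRun.IsRunOn.upV_eq_valueEstimate (hR : R.IsRunOn φ fold lam β D) {h : ℕ}
    (hh : h ≤ H) : R.upV h = valueEstimate φ fold lam β D h := by
  induction hh using Nat.decreasingInduction with
  | self => rw [valueEstimate_last, funext hR.upV_last]; rfl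
  | of_succ h hh ih =>
    rw [valueEstimate_of_lt φ fold lam β D ⟨h, hh⟩, ← ih]
    exact funext fun x => (hR.upV_eq ⟨h, hh⟩ x).trans (hR.upper_nash ⟨h, hh⟩ x).payoff_eq

theorem SPMVIRun.IsRunOn.loV_eq_valueEstimate (hR : R.IsRunOn φ fold lam β D) {h : ℕ}
    (hh : h ≤ H) : R.loV h = valueEstimate φ fold lam (-β) D h := by
  induction hh using Nat.decreasingInduction with
  | self => rw [valueEstimate_last, funext hR.loV_last]; rfl
  | of_succ h hh ih =>
    rw [valueEstimate_of_lt φ fold lam (-β) D ⟨h, hh⟩, ← ih, ← lowerQ_eq_upperQ_neg]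
    exact funext fun x => (hR.loV_eq ⟨h, hh⟩ x).trans (hR.lower_nash ⟨h, hh⟩ x).payoff_eq

theorem measurable_valueEstimate (G : MarkovGame S A B) (hφ : Measurable φ)
    (fold : Fin K → Fin H) (lam β : ℝ) {h : ℕ} (hh : h ≤ H) :
    Measurable (Function.uncurry fun ω : Fin K → Fin H → Transition S A B =>
      valueEstimate φ fold lam β (G.observe ω) h) := by
  induction hh using Nat.decreasingInduction with
  | self => simp only [valueEstimate_last]; exact measurable_const
  | of_succ h hh ih =>
    simp only [fun D => valueEstimate_of_lt φ fold lam β D ⟨h, hh⟩]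
    refine lipschitzWith_matrixGameValue.continuous.measurable.comp ?_
    exact measurable_pi_iff.mpr fun a => measurable_pi_iff.mpr fun b =>
      measurable_upperQ G hφ fold lam β ⟨h, hh⟩ ih a b

end Runs

section TransitionNoise

variable {ι Z S E Ω : Type*} [MeasurableSpace Z] [MeasurableSpace S] [MeasurableSpace Ω]

/-- The noise `∑_{τ ∈ s} (V(x'_τ) - 𝔼[V(x'_τ) | z_τ]) φ(z_τ)` of the regression of `V(x')` on the
features `φ(z)`, for transitions `(z_τ, x'_τ)` drawn from the kernel `P`. -/
def transitionNoise [AddCommGroup E] [Module ℝ E] (P : Kernel Z S) (φ : Z → E) (s : Finset ι)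
    (V : S → ℝ) (q : ι → Z × S) : E :=
  ∑ τ ∈ s, (V (q τ).2 - ∫ x, V x ∂(P (q τ).1)) • φ (q τ).1

theorem transitionNoise_congr [AddCommGroup E] [Module ℝ E] (P : Kernel Z S) (φ : Z → E)
    {s : Finset ι} (V : S → ℝ) {q q' : ι → Z × S} (hq : ∀ τ ∈ s, q τ = q' τ) :
    transitionNoise P φ s V q = transitionNoise P φ s V q' :=
  Finset.sum_congr rfl fun τ hτ => by rw [hq τ hτ]

theorem measurable_transitionNoise [NormedAddCommGroup E] [NormedSpace ℝ E] [MeasurableSpace E]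
    [BorelSpace E] [SecondCountableTopology E] (P : Kernel Z S) [IsSFiniteKernel P] {φ : Z → E}
    (hφ : Measurable φ) (s : Finset ι) {V : Ω → S → ℝ} (hV : Measurable (Function.uncurry V))
    {q : ι → Ω → Z × S} (hq : ∀ τ, Measurable (q τ)) :
    Measurable fun ω => transitionNoise P φ s (V ω) fun τ => q τ ω := by
  refine Finset.measurable_sum _ fun τ _ => ((Measurable.sub ?_ ?_).smul ?_)
  · exact hV.comp (measurable_id.prodMk (hq τ).snd)
  · exact (StronglyMeasurable.integral_kernel_prod_right'
      (κ := P.comap (fun ω => (q τ ω).1) (hq τ).fst) hV.stronglyMeasurable).measurable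
  · exact hφ.comp (hq τ).fst

theorem measure_transitionNoise_le [Fintype ι] {d : ℕ} (m : ι → Measure Z)
    [∀ i, IsProbabilityMeasure (m i)] (P : Kernel Z S) [IsMarkovKernel P]
    {φ : Z → EuclideanSpace ℝ (Fin d)} (hφ : Measurable φ) {lam : ℝ} (hlam : 0 < lam)
    (s : Finset ι) {V : S → ℝ} (hVm : Measurable V) {l u : ℝ} (hV : ∀ x, V x ∈ Set.Icc l u)
    {t : ℝ} (ht : 0 ≤ t) :
    Measure.pi (fun i => m i ⊗ₘ P) {q | √d * t <
        matNorm (regGram lam s fun τ => φ (q τ).1)⁻¹ (transitionNoise P φ s V q)} ≤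
      ENNReal.ofReal (d * (2 * Real.exp (-(2 * t ^ 2 / (u - l) ^ 2)))) := by
  refine pi_compProd_le_of_forall m (fun _ => P) ?_ fun z => ?_
  · exact measurableSet_lt measurable_const (measurable_matNorm_regGram_inv lam s
      (fun τ => by fun_prop) (measurable_transitionNoise P hφ s
        (V := fun _ => V) (hVm.comp measurable_snd) fun τ => measurable_pi_apply τ))
  · have hmean : ∀ τ, ∫ x : ι → S, V (x τ) ∂(Measure.pi fun i => P (z i)) = ∫ y, V y ∂(P (z τ)) :=
      fun τ => integral_comp_eval hVm.aestronglyMeasurable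
    have hbound := measure_matNorm_noise_le (X := fun τ (x : ι → S) => V (x τ))
      (fun τ => hVm.comp (measurable_pi_apply τ))
      (iIndepFun_pi (μ := fun i => P (z i)) fun _ => hVm.aemeasurable) (fun τ x => hV (x τ)) hlam s
      (fun τ => φ (z τ)) ht
    simp only [hmean] at hbound
    exact hbound

variable {A B : Type*} [MeasurableSpace A] [MeasurableSpace B] {H K d : ℕ}
  {φ : S × A × B → EuclideanSpace ℝ (Fin d)}

theorem MarkovGame.measure_transitionNoise_le_of_fixed (G : MarkovGame S A B) (ρ : Measure S)
    [IsProbabilityMeasure ρ] (b : Policy S (A × B)) (hφ : Measurable φ) (fold : Fin K → Fin H)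
    (h : Fin H) {lam : ℝ} (hlam : 0 < lam) {V : S → ℝ} (hVm : Measurable V) {l u : ℝ}
    (hV : ∀ x, V x ∈ Set.Icc l u) {t : ℝ} (ht : 0 ≤ t) :
    G.dataLaw ρ b H K {ω | √d * t < matNorm (gram φ fold lam (G.observe ω) h)⁻¹
        (transitionNoise (G.P h) φ {τ | fold τ = h} V fun τ => ω τ h)} ≤
      ENNReal.ofReal (d * (2 * Real.exp (-(2 * t ^ 2 / (u - l) ^ 2)))) := by
  have heval : Measurable fun ω : Fin H → Transition S A B => ω h := measurable_pi_apply h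
  have : IsProbabilityMeasure ((G.trajLaw ρ b H).map fun ω => (ω h).1) :=
    Measure.isProbabilityMeasure_map heval.fst.aemeasurable
  have hbound := measure_transitionNoise_le
    (fun _ : Fin K => (G.trajLaw ρ b H).map fun ω => (ω h).1) (G.P h) hφ hlam
    {τ | fold τ = h} hVm hV ht
  simp only [← G.map_eval_trajLaw ρ b h] at hbound
  rw [← Measure.pi_map_pi fun _ => heval.aemeasurable] at hbound
  exact (Measure.le_map_apply (f := fun (x : Fin K → Fin H → Transition S A B) i => x i h)
    (measurable_pi_iff.mpr fun i => heval.comp (measurable_pi_apply i)).aemeasurable _).trans hbound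

theorem MarkovGame.measure_transitionNoise_le (G : MarkovGame S A B) (ρ : Measure S)
    [IsProbabilityMeasure ρ] (b : Policy S (A × B)) (hφ : Measurable φ) (fold : Fin K → Fin H)
    (h : Fin H) {lam : ℝ} (hlam : 0 < lam) {V : (Fin K → Fin H → Transition S A B) → S → ℝ}
    (hVm : Measurable (Function.uncurry V))
    (hVdep : ∀ ω ω', (∀ τ, fold τ ≠ h → ω τ = ω' τ) → V ω = V ω') {l u : ℝ}
    (hV : ∀ ω x, V ω x ∈ Set.Icc l u) {t : ℝ} (ht : 0 ≤ t) :
    G.dataLaw ρ b H K {ω | √d * t < matNorm (gram φ fold lam (G.observe ω) h)⁻¹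
        (transitionNoise (G.P h) φ {τ | fold τ = h} (V ω) fun τ => ω τ h)} ≤
      ENNReal.ofReal (d * (2 * Real.exp (-(2 * t ^ 2 / (u - l) ^ 2)))) := by
  refine pi_le_of_forall_ite (fun _ => G.trajLaw ρ b H) (fun τ => fold τ = h) ?_ fun y => ?_
  · exact measurableSet_lt measurable_const (measurable_matNorm_regGram_inv lam _
      (fun τ => by fun_prop) (measurable_transitionNoise (G.P h) hφ _ hVm fun τ => by fun_prop))
  · have hbound := G.measure_transitionNoise_le_of_fixed (φ := φ) (K := K) ρ b hφ fold h hlam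
      (hVm.comp (measurable_prodMk_left (x := y))) (hV y) ht
    refine le_trans (le_of_eq ?_) hbound
    congr 1
    ext ω
    have hsplit : ∀ τ, fold τ = h → (if fold τ = h then ω τ else y τ) = ω τ :=
      fun τ hτ => if_pos hτ
    have hVy : V (fun τ => if fold τ = h then ω τ else y τ) = V y :=
      hVdep _ _ fun τ hτ => if_neg hτ
    simp only [Set.mem_ofPred_eq, hVy]
    rw [gram_congr φ lam (D' := G.observe ω) fun τ hτ => by
        funext i; simp only [MarkovGame.observe, hsplit τ hτ],
      transitionNoise_congr (G.P h) φ (V y) (q' := fun τ => ω τ h) fun τ hτ => by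
        rw [hsplit τ (Finset.mem_filter.mp hτ).2]]
    rfl

end TransitionNoise

section SmallBall

variable {Ω ι : Type*} [MeasurableSpace Ω] {P : Measure Ω}

theorem exp_neg_le_one_sub_half {y : ℝ} (hy : y ∈ Set.Icc (0 : ℝ) 1) :
    Real.exp (-y) ≤ 1 - y / 2 := by
  rw [Real.exp_neg, inv_le_iff_one_le_mul₀ (Real.exp_pos _)]
  nlinarith [Real.add_one_le_exp y, hy.1, hy.2]

theorem mgf_neg_one_le [IsProbabilityMeasure P] {X : Ω → ℝ} (hX : AEMeasurable X P)
    (hX01 : ∀ ω, X ω ∈ Set.Icc (0 : ℝ) 1) {p : ℝ} (hp : p ≤ ∫ ω, X ω ∂P) :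
    mgf X P (-1) ≤ Real.exp (-(p / 2)) := by
  have hint : Integrable X P := Integrable.of_mem_Icc 0 1 hX (ae_of_all _ hX01)
  calc mgf X P (-1) ≤ ∫ ω, (1 - X ω / 2) ∂P := by
        refine integral_mono_of_nonneg (ae_of_all _ fun ω => (Real.exp_pos _).le)
          ((integrable_const _).sub (hint.div_const 2)) (ae_of_all _ fun ω => ?_)
        simpa only [neg_one_mul] using exp_neg_le_one_sub_half (hX01 ω)
    _ = 1 - (∫ ω, X ω ∂P) / 2 := by
        rw [integral_sub (integrable_const _) (hint.div_const 2), integral_div]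
        simp
    _ ≤ Real.exp (-(p / 2)) := by linarith [Real.add_one_le_exp (-(p / 2))]

theorem measure_sum_le_le_exp {X : ι → Ω → ℝ} (hX : ∀ i, Measurable (X i))
    (hindep : iIndepFun X P) (hX01 : ∀ i ω, X i ω ∈ Set.Icc (0 : ℝ) 1) {p : ℝ}
    (hp : ∀ i, p ≤ ∫ ω, X i ω ∂P) (s : Finset ι) :
    P {ω | ∑ i ∈ s, X i ω ≤ s.card * p / 4} ≤ ENNReal.ofReal (Real.exp (-(s.card * p / 4))) := by
  have := hindep.isProbabilityMeasure
  have hsum : ∀ ω, (∑ i ∈ s, X i) ω ∈ Set.Icc (0 : ℝ) s.card := fun ω => by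
    rw [Finset.sum_apply]
    refine ⟨Finset.sum_nonneg fun i _ => (hX01 i ω).1, ?_⟩
    simpa using Finset.sum_le_sum fun i (_ : i ∈ s) => (hX01 i ω).2
  have hint : Integrable (fun ω => Real.exp (-1 * (∑ i ∈ s, X i) ω)) P :=
    Integrable.of_mem_Icc 0 1 (by fun_prop) (ae_of_all _ fun ω =>
      ⟨(Real.exp_pos _).le, Real.exp_le_one_iff.mpr (by linarith [(hsum ω).1])⟩)
  have hmgf : mgf (∑ i ∈ s, X i) P (-1) ≤ Real.exp (-(s.card * p / 2)) := by
    rw [hindep.mgf_sum hX]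
    calc ∏ i ∈ s, mgf (X i) P (-1) ≤ ∏ _i ∈ s, Real.exp (-(p / 2)) :=
          Finset.prod_le_prod (fun i _ => mgf_nonneg) fun i _ =>
            mgf_neg_one_le (hX i).aemeasurable (hX01 i) (hp i)
      _ = Real.exp (-(s.card * p / 2)) := by
          rw [Finset.prod_const, ← Real.exp_nat_mul]
          ring_nf
  rw [← ofReal_measureReal]
  refine ENNReal.ofReal_le_ofReal ?_
  have hmarkov := measure_le_le_exp_mul_mgf (s.card * p / 4) (by norm_num : (-1 : ℝ) ≤ 0) hint
  simp only [Finset.sum_apply] at hmarkov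
  calc _ ≤ _ := hmarkov
    _ ≤ Real.exp (- -1 * (s.card * p / 4)) * Real.exp (-(s.card * p / 2)) := by gcongr
    _ = _ := by rw [← Real.exp_add]; ring_nf

end SmallBall

section Eigenvalues

open Matrix hiding gram
open scoped MatrixOrder

variable {d : ℕ} {M : Matrix (Fin d) (Fin d) ℝ}

theorem minEigenvalue_mul_dotProduct_le (hM : M.IsHermitian) (v : Fin d → ℝ) :
    minEigenvalue M * (v ⬝ᵥ v) ≤ v ⬝ᵥ M *ᵥ v := by
  have hbdd : BddBelow (spectrum ℝ M) := by
    rw [hM.spectrum_real_eq_range_eigenvalues]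
    exact (Set.finite_range _).bddBelow
  have hpsd : (M - algebraMap ℝ _ (minEigenvalue M)).PosSemidef := by
    refine posSemidef_iff_isHermitian_and_spectrum_nonneg.mpr ⟨hM.sub ?_, fun x hx => ?_⟩
    · rw [algebraMap_eq_diagonal]
      exact isHermitian_diagonal _
    · rw [sub_eq_neg_add, ← spectrum.add_mem_iff (s := minEigenvalue M)] at hx
      exact nonneg_of_le_add_left (csInf_le hbdd hx)
  have hnonneg := hpsd.dotProduct_mulVec_nonneg v
  rw [star_trivial, sub_mulVec, dotProduct_sub, Algebra.algebraMap_eq_smul_one, smul_mulVec,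
    one_mulVec, dotProduct_smul, smul_eq_mul] at hnonneg
  exact sub_nonneg.mp hnonneg

theorem mul_dotProduct_le_of_forall_unit {c : ℝ}
    (hunit : ∀ v : Fin d → ℝ, v ⬝ᵥ v = 1 → c ≤ v ⬝ᵥ M *ᵥ v) (v : Fin d → ℝ) :
    c * (v ⬝ᵥ v) ≤ v ⬝ᵥ M *ᵥ v := by
  rcases eq_or_ne v 0 with rfl | hv
  · simp
  have hpos : 0 < ‖WithLp.toLp 2 v‖ := norm_pos_iff.mpr fun h => hv (by simpa using h)
  set r := ‖WithLp.toLp 2 v‖ with hr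
  have hscaled := hunit (r⁻¹ • v) (by
    rw [smul_dotProduct, dotProduct_smul, ← norm_toLp_sq, ← hr, smul_eq_mul, smul_eq_mul]
    field_simp)
  rw [mulVec_smul, smul_dotProduct, dotProduct_smul, smul_eq_mul, smul_eq_mul] at hscaled
  rw [← norm_toLp_sq, ← hr]
  calc c * r ^ 2 ≤ (r⁻¹ * (r⁻¹ * (v ⬝ᵥ M *ᵥ v))) * r ^ 2 := by gcongr
    _ = _ := by field_simp

end Eigenvalues

section Grid

open Matrix hiding gram

variable {d m : ℕ}

/-- The points `k / m - 1`, with `k` ranging over `{0, …, 2m}^d`, of a grid on the cube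
`[-1, 1]^d`. -/
def gridPoint (k : Fin d → Fin (2 * m + 1)) : Fin d → ℝ := fun i => (k i : ℝ) / m - 1

theorem exists_abs_sub_grid_le (hm : 0 < m) {x : ℝ} (hx : |x| ≤ 1) :
    ∃ k : Fin (2 * m + 1), |x - ((k : ℝ) / m - 1)| ≤ 1 / m := by
  obtain ⟨hxl, hxu⟩ := abs_le.mp hx
  have hm' : (0 : ℝ) < m := by exact_mod_cast hm
  have hle : ⌊(x + 1) * m⌋₊ ≤ 2 * m := Nat.floor_le_of_le (by push_cast; gcongr; linarith)
  refine ⟨⟨⌊(x + 1) * m⌋₊, Nat.lt_succ_of_le hle⟩, ?_⟩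
  have hfloor := Nat.floor_le (mul_nonneg (by linarith) hm'.le : 0 ≤ (x + 1) * m)
  have hfloor' := Nat.lt_floor_add_one ((x + 1) * m)
  rw [show x - ((⌊(x + 1) * m⌋₊ : ℝ) / m - 1) = ((x + 1) * m - ⌊(x + 1) * m⌋₊) / m by
    field_simp; ring, abs_div, Nat.abs_cast]
  gcongr
  exact abs_le.mpr ⟨by linarith, by linarith⟩

theorem exists_gridPoint (hm : 0 < m) {v : Fin d → ℝ} (hv : ∀ i, |v i| ≤ 1) :
    ∃ k : Fin d → Fin (2 * m + 1),
      (v - gridPoint k) ⬝ᵥ (v - gridPoint k) ≤ d / (m : ℝ) ^ 2 := by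
  choose k hk using fun i => exists_abs_sub_grid_le hm (hv i)
  refine ⟨k, ?_⟩
  calc (v - gridPoint k) ⬝ᵥ (v - gridPoint k) ≤ ∑ _i : Fin d, (1 / (m : ℝ)) ^ 2 :=
        Finset.sum_le_sum fun i _ => by
          rw [← sq, ← sq_abs]
          exact pow_le_pow_left₀ (abs_nonneg _) (hk i) 2
    _ = d / (m : ℝ) ^ 2 := by simp [div_eq_mul_inv]

theorem abs_apply_le_one_of_dotProduct_self {v : Fin d → ℝ} (hv : v ⬝ᵥ v = 1) (i : Fin d) :
    |v i| ≤ 1 := by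
  rw [← sq_le_one_iff_abs_le_one, ← hv, sq]
  exact Finset.single_le_sum (f := fun i => v i * v i) (fun j _ => mul_self_nonneg (v j))
    (Finset.mem_univ i)

theorem dotProduct_self_mem_Icc_of_sub {v g : Fin d → ℝ} (hv : v ⬝ᵥ v = 1)
    (hvg : (v - g) ⬝ᵥ (v - g) ≤ 1 / 4) : g ⬝ᵥ g ∈ Set.Icc (1 / 4 : ℝ) 4 := by
  rw [← norm_toLp_sq] at hv hvg ⊢
  rw [WithLp.toLp_sub] at hvg
  have hv' : ‖WithLp.toLp 2 v‖ = 1 := (pow_eq_one_iff_of_nonneg (norm_nonneg _) two_ne_zero).mp hv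
  have hvg' : ‖WithLp.toLp 2 v - WithLp.toLp 2 g‖ ≤ 1 / 2 :=
    abs_le_of_sq_le_sq' (hvg.trans (by norm_num)) (by norm_num) |>.2
  have hlower := norm_sub_norm_le (WithLp.toLp 2 v) (WithLp.toLp 2 g)
  have hupper := norm_le_norm_add_norm_sub (WithLp.toLp 2 v) (WithLp.toLp 2 g)
  constructor <;> nlinarith

theorem dotProduct_sq_le {f : EuclideanSpace ℝ (Fin d)} (hf : ‖f‖ ≤ 1) (v : Fin d → ℝ) :
    (f.ofLp ⬝ᵥ v) ^ 2 ≤ v ⬝ᵥ v := by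
  have hinner : |f.ofLp ⬝ᵥ v| ≤ ‖f‖ * ‖WithLp.toLp 2 v‖ := by
    rw [← inner_eq_dotProduct f (WithLp.toLp 2 v)]
    exact abs_real_inner_le_norm _ _
  rw [← norm_toLp_sq, ← sq_abs]
  gcongr
  exact hinner.trans (mul_le_of_le_one_left (norm_nonneg _) hf)

variable {ι : Type*} {s : Finset ι} {f : ι → EuclideanSpace ℝ (Fin d)}

theorem sum_dotProduct_sq_le (hf : ∀ τ, ‖f τ‖ ≤ 1) (v g : Fin d → ℝ) :
    ∑ τ ∈ s, ((f τ).ofLp ⬝ᵥ g) ^ 2 ≤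
      2 * ∑ τ ∈ s, ((f τ).ofLp ⬝ᵥ v) ^ 2 + 2 * (s.card * ((v - g) ⬝ᵥ (v - g))) := by
  calc _ ≤ ∑ τ ∈ s, (2 * ((f τ).ofLp ⬝ᵥ v) ^ 2 + 2 * ((v - g) ⬝ᵥ (v - g))) :=
        Finset.sum_le_sum fun τ _ => by
          have herror := dotProduct_sq_le (hf τ) (v - g)
          rw [dotProduct_sub] at herror
          nlinarith [sq_nonneg (2 * ((f τ).ofLp ⬝ᵥ v) - (f τ).ofLp ⬝ᵥ g)]
    _ = _ := by
        rw [Finset.sum_add_distrib, Finset.sum_const, nsmul_eq_mul, ← Finset.mul_sum]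
        ring

/- A grid of mesh `1 / (2 d n)` is fine enough for the rounding error over all `n` summands to be
absorbed by the regularization. -/
theorem mul_dotProduct_le_regGram_of_grid {lam : ℝ} (hlam : 1 / 4 ≤ lam) (hf : ∀ τ, ‖f τ‖ ≤ 1)
    (hs : 0 < s.card) {c : ℝ}
    (hgrid : ∀ k : Fin d → Fin (2 * (2 * d * s.card) + 1),
      gridPoint k ⬝ᵥ gridPoint k ∈ Set.Icc (1 / 4 : ℝ) 4 →
        2 * c ≤ ∑ τ ∈ s, ((f τ).ofLp ⬝ᵥ gridPoint k) ^ 2)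
    (v : Fin d → ℝ) : c * (v ⬝ᵥ v) ≤ v ⬝ᵥ regGram lam s f *ᵥ v := by
  refine mul_dotProduct_le_of_forall_unit (fun v hv => ?_) v
  have hd : 0 < d := Nat.pos_of_ne_zero fun h => by subst h; simp at hv
  obtain ⟨k, hk⟩ := exists_gridPoint (m := 2 * d * s.card) (by positivity)
    (abs_apply_le_one_of_dotProduct_self hv)
  have hd1 : (1 : ℝ) ≤ d := by exact_mod_cast hd
  have hn1 : (1 : ℝ) ≤ s.card := by exact_mod_cast hs
  have herror : s.card * ((v - gridPoint k) ⬝ᵥ (v - gridPoint k)) ≤ 1 / 4 := by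
    calc _ ≤ s.card * ((d : ℝ) / ((2 * d * s.card : ℕ) : ℝ) ^ 2) := by gcongr
      _ = 1 / (4 * (d * s.card)) := by push_cast; field_simp; ring
      _ ≤ 1 / (4 * (1 * 1)) := by gcongr
      _ = 1 / 4 := by norm_num
  have hnear : (v - gridPoint k) ⬝ᵥ (v - gridPoint k) ≤ 1 / 4 :=
    (le_mul_of_one_le_left (by rw [← norm_toLp_sq]; positivity) hn1).trans herror
  have hlower := hgrid k (dotProduct_self_mem_Icc_of_sub hv hnear)
  rw [dotProduct_regGram_mulVec, hv]
  linarith [sum_dotProduct_sq_le (s := s) hf v (gridPoint k)]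

end Grid

section Coverage

open Matrix hiding gram

variable {Ω : Type*} [MeasurableSpace Ω] {d : ℕ}

theorem integral_dotProduct_sq (P : Measure Ω) [IsFiniteMeasure P]
    {f : Ω → EuclideanSpace ℝ (Fin d)} (hf : Measurable f) {M : ℝ} (hM : ∀ ω, ‖f ω‖ ≤ M)
    (g : Fin d → ℝ) :
    ∫ ω, ((f ω).ofLp ⬝ᵥ g) ^ 2 ∂P =
      g ⬝ᵥ (Matrix.of fun i j => ∫ ω, f ω i * f ω j ∂P) *ᵥ g := by
  have hint : ∀ i j, Integrable (fun ω => f ω i * f ω j) P := fun i j => by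
    refine Integrable.of_bound (by fun_prop) (M * M) (ae_of_all _ fun ω => ?_)
    have hi : ∀ i, ‖f ω i‖ ≤ M := fun i => (PiLp.norm_apply_le (f ω) i).trans (hM ω)
    rw [norm_mul]
    exact mul_le_mul (hi i) (hi j) (norm_nonneg _) ((norm_nonneg _).trans (hi i))
  have hexpand : ∀ ω, ((f ω).ofLp ⬝ᵥ g) ^ 2 = ∑ i, ∑ j, g i * g j * (f ω i * f ω j) := fun ω => by
    rw [sq, dotProduct, Finset.sum_mul_sum]
    exact Finset.sum_congr rfl fun i _ => Finset.sum_congr rfl fun j _ => by ring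
  simp only [hexpand]
  rw [integral_finsetSum _ fun i _ => integrable_finsetSum _ fun j _ => (hint i j).const_mul _]
  simp_rw [integral_finsetSum _ fun j (_ : j ∈ Finset.univ) => (hint _ j).const_mul _,
    integral_const_mul]
  simp only [dotProduct, mulVec, of_apply, Finset.mul_sum]
  exact Finset.sum_congr rfl fun i _ => Finset.sum_congr rfl fun j _ => by ring

variable {S A B : Type*} [MeasurableSpace S] [MeasurableSpace A] [MeasurableSpace B] {H K : ℕ}
  {φ : S × A × B → EuclideanSpace ℝ (Fin d)}

theorem MarkovGame.isHermitian_featureCov (G : MarkovGame S A B) (ρ : Measure S)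
    (b : Policy S (A × B)) (φ : S × A × B → EuclideanSpace ℝ (Fin d)) (h : Fin H) :
    (G.featureCov ρ b φ h).IsHermitian := by
  ext i j
  simp only [MarkovGame.featureCov, conjTranspose_apply, of_apply, star_trivial, mul_comm]

theorem MarkovGame.coverage_mul_le (G : MarkovGame S A B) (ρ : Measure S)
    [IsProbabilityMeasure ρ] (b : Policy S (A × B)) (hφ : Measurable φ) (hφ1 : ∀ z, ‖φ z‖ ≤ 1)
    (h : Fin H) (g : Fin d → ℝ) :
    G.coverage ρ b H φ * (g ⬝ᵥ g) ≤ ∫ ω, ((φ (ω h).1).ofLp ⬝ᵥ g) ^ 2 ∂(G.trajLaw ρ b H) := by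
  calc G.coverage ρ b H φ * (g ⬝ᵥ g) ≤ minEigenvalue (G.featureCov ρ b φ h) * (g ⬝ᵥ g) :=
        mul_le_mul_of_nonneg_right (ciInf_le (Set.finite_range _).bddBelow h)
          (by rw [← norm_toLp_sq]; positivity)
    _ ≤ g ⬝ᵥ G.featureCov ρ b φ h *ᵥ g :=
        minEigenvalue_mul_dotProduct_le (G.isHermitian_featureCov ρ b φ h) g
    _ = _ := (integral_dotProduct_sq _ (by fun_prop) (fun ω => hφ1 _) g).symm

theorem MarkovGame.measure_sum_dotProduct_sq_le (G : MarkovGame S A B) (ρ : Measure S)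
    [IsProbabilityMeasure ρ] (b : Policy S (A × B)) (hφ : Measurable φ) (hφ1 : ∀ z, ‖φ z‖ ≤ 1)
    (h : Fin H) (s : Finset (Fin K)) {κ : ℝ} (hκ : 0 ≤ κ) (hκ' : κ ≤ G.coverage ρ b H φ)
    {g : Fin d → ℝ} (hg : g ⬝ᵥ g ∈ Set.Icc (1 / 4 : ℝ) 4) :
    G.dataLaw ρ b H K {ω | ∑ τ ∈ s, ((φ (ω τ h).1).ofLp ⬝ᵥ g) ^ 2 ≤ s.card * κ / 16} ≤
      ENNReal.ofReal (Real.exp (-(s.card * κ / 64))) := by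
  set X : (Fin H → Transition S A B) → ℝ := fun ω => ((φ (ω h).1).ofLp ⬝ᵥ g) ^ 2 / 4 with hX
  have hXm : Measurable X := by simp only [hX, dotProduct]; fun_prop
  have hX01 : ∀ ω, X ω ∈ Set.Icc (0 : ℝ) 1 := fun ω =>
    ⟨by positivity, by simp only [hX]; linarith [dotProduct_sq_le (hφ1 (ω h).1) g, hg.2]⟩
  have hmean : κ / 16 ≤ ∫ ω, X ω ∂(G.trajLaw ρ b H) := by
    rw [integral_div]
    have := G.coverage_mul_le ρ b hφ hφ1 h g
    nlinarith [mul_le_mul hκ' hg.1 (by norm_num) (hκ.trans hκ')]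
  have hchernoff := measure_sum_le_le_exp (P := G.dataLaw ρ b H K) (X := fun τ ω => X (ω τ))
    (fun τ => by fun_prop) (iIndepFun_pi fun _ => hXm.aemeasurable) (fun τ ω => hX01 (ω τ))
    (fun τ => hmean.trans_eq (integral_comp_eval (μ := fun _ : Fin K => G.trajLaw ρ b H) (i := τ)
      hXm.aestronglyMeasurable).symm) s
  convert hchernoff using 3
  · simp only [hX, ← Finset.sum_div]
    ext
    constructor <;> intro <;> linarith
  · ring_nf

theorem MarkovGame.measure_gram_lt_le (G : MarkovGame S A B) (ρ : Measure S)
    [IsProbabilityMeasure ρ] (b : Policy S (A × B)) (hφ : Measurable φ) (hφ1 : ∀ z, ‖φ z‖ ≤ 1)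
    (fold : Fin K → Fin H) (h : Fin H) {lam : ℝ} (hlam : 1 / 4 ≤ lam) {n : ℕ}
    (hn : (Finset.univ.filter fun τ => fold τ = h).card = n) (hn0 : 0 < n) {κ : ℝ} (hκ : 0 ≤ κ)
    (hκ' : κ ≤ G.coverage ρ b H φ) :
    G.dataLaw ρ b H K {ω | ∃ v : Fin d → ℝ,
        v ⬝ᵥ gram φ fold lam (G.observe ω) h *ᵥ v < n * κ / 32 * (v ⬝ᵥ v)} ≤
      ENNReal.ofReal ((4 * d * n + 1) ^ d * Real.exp (-(n * κ / 64))) := by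
  subst hn
  set s := Finset.univ.filter fun τ => fold τ = h
  obtain ⟨grid, hgrid⟩ : ∃ grid : Finset (Fin d → Fin (2 * (2 * d * s.card) + 1)),
      ∀ k, k ∈ grid ↔ gridPoint k ⬝ᵥ gridPoint k ∈ Set.Icc (1 / 4 : ℝ) 4 :=
    ⟨Finset.univ.filter _, fun k => Finset.mem_filter_univ k⟩
  have hcard : (grid.card : ℝ) ≤ (4 * d * s.card + 1) ^ d := by
    have := grid.card_le_univ
    rw [Fintype.card_fun, Fintype.card_fin, Fintype.card_fin] at this
    calc (grid.card : ℝ) ≤ ((2 * (2 * d * s.card) + 1) ^ d : ℕ) := by exact_mod_cast this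
      _ = (4 * d * s.card + 1) ^ d := by push_cast; ring
  have hsub : {ω : Fin K → Fin H → Transition S A B | ∃ v : Fin d → ℝ,
        v ⬝ᵥ gram φ fold lam (G.observe ω) h *ᵥ v < s.card * κ / 32 * (v ⬝ᵥ v)} ⊆
      ⋃ k ∈ grid,
        {ω | ∑ τ ∈ s, ((φ (ω τ h).1).ofLp ⬝ᵥ gridPoint k) ^ 2 ≤ s.card * κ / 16} := by
    rintro ω ⟨v, hv⟩
    by_contra hcon
    simp only [hgrid, Set.mem_iUnion, Set.mem_ofPred_eq, not_exists, not_le] at hcon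
    refine hv.not_ge (mul_dotProduct_le_regGram_of_grid hlam (fun τ => hφ1 _) hn0
      (fun k hk => ?_) v)
    exact (by ring : _ = s.card * κ / 16).trans_le (hcon k hk).le
  calc _ ≤ ∑ k ∈ grid, G.dataLaw ρ b H K
          {ω | ∑ τ ∈ s, ((φ (ω τ h).1).ofLp ⬝ᵥ gridPoint k) ^ 2 ≤ s.card * κ / 16} :=
        (measure_mono hsub).trans (measure_biUnion_finset_le _ _)
    _ ≤ ∑ _k ∈ grid, ENNReal.ofReal (Real.exp (-(s.card * κ / 64))) :=
        Finset.sum_le_sum fun k hk => G.measure_sum_dotProduct_sq_le ρ b hφ hφ1 h s hκ hκ'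
          ((hgrid k).mp hk)
    _ = ENNReal.ofReal (grid.card * Real.exp (-(s.card * κ / 64))) := by
        rw [Finset.sum_const, nsmul_eq_mul, ENNReal.ofReal_mul (by positivity),
          ENNReal.ofReal_natCast]
    _ ≤ _ := ENNReal.ofReal_le_ofReal (mul_le_mul_of_nonneg_right hcard (Real.exp_pos _).le)

end Coverage

section Comparison

variable {S A B : Type*} [MeasurableSpace S] [MeasurableSpace A] [MeasurableSpace B]
  {g g' : ℕ → S × A × B → ℝ} {M M' : ℝ} {H : ℕ}

namespace MarkovGame

theorem value_eq_expectedSum (G : MarkovGame S A B) (H : ℕ) (π : Policy S A) (ν : Policy S B)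
    (h : ℕ) (x : S) : G.value H π ν h x = G.expectedSum (π.joint ν) G.r (H - h) h x := rfl

theorem abs_r_le (G : MarkovGame S A B) (h : ℕ) (z : S × A × B) : |G.r h z| ≤ 1 :=
  abs_le.mpr ⟨by linarith [(G.r_mem h z).1], (G.r_mem h z).2⟩

theorem value_mem_Icc (G : MarkovGame S A B) (H : ℕ) (π : Policy S A) (ν : Policy S B)
    (h : ℕ) (x : S) : G.value H π ν h x ∈ Set.Icc (0 : ℝ) H := by
  refine ⟨G.expectedSum_nonneg _ (fun h z => (G.r_mem h z).1) _ _ _, ?_⟩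
  calc G.value H π ν h x ≤ (H - h : ℕ) * 1 :=
        (le_abs_self _).trans (G.abs_expectedSum_le _ G.abs_r_le _ _ x)
    _ ≤ H := by rw [mul_one]; exact_mod_cast Nat.sub_le _ _

theorem expectedSum_add_const_mul (G : MarkovGame S A B) (σ : Policy S (A × B))
    (hg : ∀ h, Measurable (g h)) (hM : ∀ h z, |g h z| ≤ M) (hg' : ∀ h, Measurable (g' h))
    (hM' : ∀ h z, |g' h z| ≤ M') (c : ℝ) (n h : ℕ) (x : S) :
    G.expectedSum σ (fun h z => g h z + c * g' h z) n h x =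
      G.expectedSum σ g n h x + c * G.expectedSum σ g' n h x := by
  have hsum : ∀ ω : Fin n → Transition S A B, stepSum (fun h z => g h z + c * g' h z) h ω =
      stepSum g h ω + c * stepSum g' h ω := fun ω => by
    simp only [stepSum, Finset.sum_add_distrib, Finset.mul_sum]
  simp only [expectedSum, hsum]
  rw [integral_add (G.integrable_stepSum σ hg hM n h h x)
    ((G.integrable_stepSum σ hg' hM' n h h x).const_mul c), integral_const_mul]

variable [Fintype A] [MeasurableSingletonClass A] [Fintype B] [MeasurableSingletonClass B]

theorem expectedSum_eq_payoff (G : MarkovGame S A B) (π : Policy S A) (ν : Policy S B)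
    (hg : ∀ h, Measurable (g h)) (hM : ∀ h z, |g h z| ≤ M) {h : ℕ} (hh : h < H) (x : S) :
    G.expectedSum (π.joint ν) g (H - h) h x =
      payoff (fun a b => g h (x, a, b) +
        ∫ y, G.expectedSum (π.joint ν) g (H - (h + 1)) (h + 1) y ∂(G.P h (x, a, b)))
        (π.prob h x) (ν.prob h x) := by
  rw [show H - h = H - (h + 1) + 1 by omega, G.expectedSum_succ _ hg hM, Policy.integral_joint]

theorem le_expectedSum_of_le_payoff (G : MarkovGame S A B) (π : Policy S A) (ν : Policy S B)
    (hg : ∀ h, Measurable (g h)) (hM : ∀ h z, |g h z| ≤ M) {W : ℕ → S → ℝ}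
    (hWi : ∀ h < H, ∀ z, Integrable (W (h + 1)) (G.P h z)) (hWH : ∀ x, W H x = 0)
    (hW : ∀ h < H, ∀ x, W h x ≤ payoff (fun a b => g h (x, a, b) +
      ∫ y, W (h + 1) y ∂(G.P h (x, a, b))) (π.prob h x) (ν.prob h x))
    {h : ℕ} (hh : h ≤ H) (x : S) : W h x ≤ G.expectedSum (π.joint ν) g (H - h) h x := by
  induction hh using Nat.decreasingInduction generalizing x with
  | self => rw [hWH, Nat.sub_self, G.expectedSum_zero]
  | of_succ h hh ih =>
    rw [G.expectedSum_eq_payoff π ν hg hM hh]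
    refine (hW h hh x).trans (payoff_mono (π.prob_mem_stdSimplex h x) (ν.prob_mem_stdSimplex h x)
      fun a b => add_le_add le_rfl ?_)
    exact integral_mono (hWi h hh _) (G.integrable_expectedSum _ hg hM _ _ _) ih

theorem expectedSum_le_of_payoff_le (G : MarkovGame S A B) (π : Policy S A) (ν : Policy S B)
    (hg : ∀ h, Measurable (g h)) (hM : ∀ h z, |g h z| ≤ M) {W : ℕ → S → ℝ}
    (hWi : ∀ h < H, ∀ z, Integrable (W (h + 1)) (G.P h z)) (hWH : ∀ x, W H x = 0)
    (hW : ∀ h < H, ∀ x, payoff (fun a b => g h (x, a, b) +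
      ∫ y, W (h + 1) y ∂(G.P h (x, a, b))) (π.prob h x) (ν.prob h x) ≤ W h x)
    {h : ℕ} (hh : h ≤ H) (x : S) : G.expectedSum (π.joint ν) g (H - h) h x ≤ W h x := by
  induction hh using Nat.decreasingInduction generalizing x with
  | self => rw [hWH, Nat.sub_self, G.expectedSum_zero]
  | of_succ h hh ih =>
    rw [G.expectedSum_eq_payoff π ν hg hM hh]
    refine le_trans (payoff_mono (π.prob_mem_stdSimplex h x) (ν.prob_mem_stdSimplex h x)
      fun a b => add_le_add le_rfl ?_) (hW h hh x)
    exact integral_mono (G.integrable_expectedSum _ hg hM _ _ _) (hWi h hh _) ih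

end MarkovGame

end Comparison

section Accuracy

open Matrix hiding gram

variable {S A B : Type*} [MeasurableSpace S] [MeasurableSpace A] [MeasurableSpace B]
  {H K d : ℕ} {G : MarkovGame S A B} {φ : S × A × B → EuclideanSpace ℝ (Fin d)}
  {fold : Fin K → Fin H} {lam β : ℝ} {D : Fin K → Fin H → Sample S A B} {h : Fin H} {V : S → ℝ}

theorem MarkovGame.backup_mem_Icc (G : MarkovGame S A B)
    (hV : ∀ x, V x ∈ Set.Icc (0 : ℝ) ((H : ℝ) - (h + 1 : ℕ))) (z : S × A × B) :
    G.r h z + ∫ y, V y ∂(G.P h z) ∈ Set.Icc (0 : ℝ) ((H : ℝ) - h) := by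
  have hr := G.r_mem h z
  have hnonneg : 0 ≤ ∫ y, V y ∂(G.P h z) := integral_nonneg fun x => (hV x).1
  have hle : ‖∫ y, V y ∂(G.P h z)‖ ≤ ((H : ℝ) - (h + 1 : ℕ)) * (G.P h z).real Set.univ :=
    norm_integral_le_of_norm_le_const (ae_of_all _ fun x => by
      rw [Real.norm_of_nonneg (hV x).1]; exact (hV x).2)
  rw [probReal_univ, mul_one, Real.norm_of_nonneg hnonneg] at hle
  push_cast at hle
  exact ⟨add_nonneg hr.1 hnonneg, by linarith [hr.2]⟩

theorem MarkovGame.IsLinear.exists_backup_eq_inner (hG : G.IsLinear H φ) (h : Fin H)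
    (hVm : Measurable V) (hV : ∀ x, V x ∈ Set.Icc (0 : ℝ) ((H : ℝ) - (h + 1 : ℕ))) :
    ∃ w : EuclideanSpace ℝ (Fin d), ‖w‖ ≤ √d * H ∧
      ∀ z, G.r h z + ∫ y, V y ∂(G.P h z) = inner ℝ (φ z) w := by
  obtain ⟨μ, hμP, hμ⟩ := hG.transition h h.2
  obtain ⟨θ, hθr, hθ⟩ := hG.reward h h.2
  have hlen : (0 : ℝ) ≤ (H : ℝ) - (h + 1 : ℕ) := sub_nonneg.mpr (by exact_mod_cast h.2)
  obtain ⟨w, hw, hwP⟩ :=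
    exists_integral_eq_inner_of_linear (fun z => G.P h z) φ μ hμP hμ hVm hlen hV
  refine ⟨θ + w, ?_, fun z => by rw [hθr, hwP, ← inner_add_right]⟩
  calc ‖θ + w‖ ≤ √d + √d * ((H : ℝ) - (h + 1 : ℕ)) := (norm_add_le _ _).trans (add_le_add hθ hw)
    _ = √d * (H - h) := by push_cast; ring
    _ ≤ √d * H := by gcongr; exact sub_le_self _ (Nat.cast_nonneg _)

/-- The ridge regression of step `h` approximates the Bellman backup of `V` up to the bonus. This is
the event on which the estimates of SPMVI are optimistic and pessimistic, respectively. -/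
def IsAccurate (G : MarkovGame S A B) (φ : S × A × B → EuclideanSpace ℝ (Fin d))
    (fold : Fin K → Fin H) (lam β : ℝ) (D : Fin K → Fin H → Sample S A B) (h : Fin H)
    (V : S → ℝ) : Prop :=
  ∀ z, |(φ z).ofLp ⬝ᵥ ridge φ fold lam D h V - (G.r h z + ∫ y, V y ∂(G.P h z))| ≤
    bonus φ fold lam β D h z

theorem MarkovGame.IsLinear.isAccurate (hG : G.IsLinear H φ) (fold : Fin K → Fin H)
    (hlam : 0 < lam) (h : Fin H) (hVm : Measurable V)
    (hV : ∀ x, V x ∈ Set.Icc (0 : ℝ) ((H : ℝ) - (h + 1 : ℕ)))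
    (ω : Fin K → Fin H → Transition S A B) {t : ℝ}
    (hnoise : matNorm (gram φ fold lam (G.observe ω) h)⁻¹
      (transitionNoise (G.P h) φ {τ | fold τ = h} V fun τ => ω τ h) ≤ t)
    (hβ : t + √lam * (√d * H) ≤ β) : IsAccurate G φ fold lam β (G.observe ω) h V := by
  intro z
  obtain ⟨w, hw, hback⟩ := hG.exists_backup_eq_inner h hVm hV
  have hridge := abs_ridge_sub_le {τ | fold τ = h} (fun τ => φ (ω τ h).1) hlam
    (y := fun τ => G.r h (ω τ h).1 + V (ω τ h).2)
    (e := fun τ => V (ω τ h).2 - ∫ y, V y ∂(G.P h (ω τ h).1)) (w := w)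
    (fun τ _ => by rw [← hback]; ring) (φ z)
  rw [hback z, bonus, mul_comm β]
  refine hridge.trans (mul_le_mul_of_nonneg_left ?_ (matNorm_nonneg _ _))
  exact (add_le_add hnoise (mul_le_mul_of_nonneg_left hw (Real.sqrt_nonneg _))).trans hβ

theorem IsAccurate.upperQ_mem_Icc (hacc : IsAccurate G φ fold lam β D h V)
    (hV : ∀ x, V x ∈ Set.Icc (0 : ℝ) ((H : ℝ) - (h + 1 : ℕ))) (z : S × A × B) :
    upperQ φ fold lam β D h V z ∈ Set.Icc (G.r h z + ∫ y, V y ∂(G.P h z))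
      (G.r h z + ∫ y, V y ∂(G.P h z) + 2 * bonus φ fold lam β D h z) := by
  have herr := abs_le.mp (hacc z)
  have hback := G.backup_mem_Icc hV z
  have hbonus : 0 ≤ bonus φ fold lam β D h z := (abs_nonneg _).trans (hacc z)
  constructor
  · exact le_max_of_le_right (le_min (by linarith) hback.2)
  · exact max_le (by linarith [hback.1, hbonus]) ((min_le_left _ _).trans (by linarith))

theorem IsAccurate.lowerQ_mem_Icc (hacc : IsAccurate G φ fold lam β D h V)
    (hV : ∀ x, V x ∈ Set.Icc (0 : ℝ) ((H : ℝ) - (h + 1 : ℕ))) (z : S × A × B) :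
    lowerQ φ fold lam β D h V z ∈ Set.Icc
      (G.r h z + ∫ y, V y ∂(G.P h z) - 2 * bonus φ fold lam β D h z)
      (G.r h z + ∫ y, V y ∂(G.P h z)) := by
  have herr := abs_le.mp (hacc z)
  have hback := G.backup_mem_Icc hV z
  have hbonus : 0 ≤ bonus φ fold lam β D h z := (abs_nonneg _).trans (hacc z)
  constructor
  · exact le_max_of_le_right (le_min (by linarith) (by linarith [hback.2, hbonus]))
  · exact max_le hback.1 ((min_le_left _ _).trans (by linarith))

end Accuracy

section Uncertainty

open Matrix hiding gram

variable {S A B : Type*} {H K d : ℕ}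

/-- The summands `‖φ‖_{Λ_h⁻¹}` of the uncertainty as a sequence of functions, extended by `0` past
the horizon. -/
def featureNormSeq (φ : S × A × B → EuclideanSpace ℝ (Fin d))
    (Λ : Fin H → Matrix (Fin d) (Fin d) ℝ) (h : ℕ) (z : S × A × B) : ℝ :=
  if hh : h < H then matNorm (Λ ⟨h, hh⟩)⁻¹ (φ z) else 0

variable {φ : S × A × B → EuclideanSpace ℝ (Fin d)} {Λ : Fin H → Matrix (Fin d) (Fin d) ℝ}

theorem featureNormSeq_val (h : Fin H) (z : S × A × B) :
    featureNormSeq φ Λ h z = matNorm (Λ h)⁻¹ (φ z) :=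
  dif_pos h.2

theorem featureNormSeq_nonneg (h : ℕ) (z : S × A × B) : 0 ≤ featureNormSeq φ Λ h z := by
  unfold featureNormSeq
  split_ifs
  exacts [matNorm_nonneg _ _, le_rfl]

theorem abs_featureNormSeq_le {M : ℝ} (hM₀ : 0 ≤ M) (hM : ∀ h z, matNorm (Λ h)⁻¹ (φ z) ≤ M)
    (h : ℕ) (z : S × A × B) : |featureNormSeq φ Λ h z| ≤ M := by
  rw [abs_of_nonneg (featureNormSeq_nonneg h z), featureNormSeq]
  split_ifs
  exacts [hM _ z, hM₀]

theorem matNorm_gram_inv_le (hφ1 : ∀ z, ‖φ z‖ ≤ 1) (fold : Fin K → Fin H) {lam : ℝ}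
    (hlam : 0 < lam) (D : Fin K → Fin H → Sample S A B) (h : Fin H) (z : S × A × B) :
    matNorm (gram φ fold lam D h)⁻¹ (φ z) ≤ 1 / √lam :=
  (matNorm_regGram_inv_le _ _ hlam (φ z)).trans (by gcongr; exact hφ1 z)

theorem matNorm_gram_inv_le_of_le (hφ1 : ∀ z, ‖φ z‖ ≤ 1) {fold : Fin K → Fin H} {lam : ℝ}
    (hlam : 0 < lam) {D : Fin K → Fin H → Sample S A B} {h : Fin H} {α : ℝ} (hα : 0 < α)
    (hL : ∀ v, α * (v ⬝ᵥ v) ≤ v ⬝ᵥ gram φ fold lam D h *ᵥ v) (z : S × A × B) :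
    matNorm (gram φ fold lam D h)⁻¹ (φ z) ≤ 1 / √α :=
  (matNorm_inv_le (posDef_regGram _ _ hlam) hα hL (φ z)).trans (by gcongr; exact hφ1 z)

variable [MeasurableSpace S] [MeasurableSpace A] [MeasurableSpace B]

theorem measurable_matNorm (M : Matrix (Fin d) (Fin d) ℝ) : Measurable (matNorm M) := by
  unfold matNorm dotProduct mulVec dotProduct
  fun_prop

theorem measurable_featureNormSeq (hφ : Measurable φ) (h : ℕ) :
    Measurable (featureNormSeq φ Λ h) := by
  by_cases hh : h < H
  · have hval : featureNormSeq φ Λ h = matNorm (Λ ⟨h, hh⟩)⁻¹ ∘ φ :=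
      funext (featureNormSeq_val ⟨h, hh⟩)
    exact hval ▸ (measurable_matNorm _).comp hφ
  · have hval : featureNormSeq φ Λ h = fun _ => 0 := funext fun _ => dif_neg hh
    exact hval ▸ measurable_const

namespace MarkovGame

theorem expectedSum_featureNormSeq (G : MarkovGame S A B) (hφ : Measurable φ) {M : ℝ}
    (hM : ∀ h z, matNorm (Λ h)⁻¹ (φ z) ≤ M) (π : Policy S A) (ν : Policy S B) (x : S) :
    G.expectedSum (π.joint ν) (featureNormSeq φ Λ) H 0 x = G.uncertainty φ Λ π ν x := by
  simp only [expectedSum, stepSum, zero_add, featureNormSeq_val, uncertainty]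
  refine integral_finsetSum _ fun j _ => Integrable.of_bound
    ((measurable_matNorm _).comp (hφ.comp (measurable_pi_apply j).fst)).aestronglyMeasurable M
    (ae_of_all _ fun ω => ?_)
  rw [Real.norm_of_nonneg (matNorm_nonneg _ _)]
  exact hM _ _

theorem mul_expectedSum_featureNormSeq_le (G : MarkovGame S A B) {β M : ℝ} (hβ : 0 ≤ β)
    (hM₀ : 0 ≤ M) (hM : ∀ h z, matNorm (Λ h)⁻¹ (φ z) ≤ M) (σ : Policy S (A × B)) (h : ℕ) (x : S) :
    2 * β * G.expectedSum σ (featureNormSeq φ Λ) (H - h) h x ≤ 2 * (H * (β * M)) := by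
  have hsum : G.expectedSum σ (featureNormSeq φ Λ) (H - h) h x ≤ H * M :=
    calc _ ≤ (H - h : ℕ) * M :=
          (le_abs_self _).trans (G.abs_expectedSum_le σ (abs_featureNormSeq_le hM₀ hM) _ _ x)
      _ ≤ H * M := by gcongr; exact Nat.sub_le _ _
  calc _ ≤ 2 * β * (H * M) := by gcongr
    _ = 2 * (H * (β * M)) := by ring

theorem uncertainty_nonneg (G : MarkovGame S A B) (π : Policy S A) (ν : Policy S B) (x : S) :
    0 ≤ G.uncertainty φ Λ π ν x :=
  Finset.sum_nonneg fun _ _ => integral_nonneg fun _ => matNorm_nonneg _ _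

theorem uncertainty_le (G : MarkovGame S A B) {M : ℝ} (hM : ∀ h z, matNorm (Λ h)⁻¹ (φ z) ≤ M)
    (π : Policy S A) (ν : Policy S B) (x : S) : G.uncertainty φ Λ π ν x ≤ H * M := by
  have hterm : ∀ h : Fin H, ∫ ω, matNorm (Λ h)⁻¹ (φ (ω h).1) ∂(G.traj (π.joint ν) H 0 x) ≤ M :=
    fun h => by
      refine (le_abs_self _).trans ?_
      simpa using norm_integral_le_of_norm_le_const (μ := G.traj (π.joint ν) H 0 x)
        (f := fun ω => matNorm (Λ h)⁻¹ (φ (ω h).1)) (ae_of_all _ fun ω => by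
          rw [Real.norm_of_nonneg (matNorm_nonneg _ _)]; exact hM h _)
  calc G.uncertainty φ Λ π ν x ≤ ∑ _h : Fin H, M := Finset.sum_le_sum fun h _ => hterm h
    _ = H * M := by simp

end MarkovGame

end Uncertainty

section Sandwich

open Matrix hiding gram

variable {S A B : Type*} [MeasurableSpace S] [MeasurableSpace A] [MeasurableSpace B]
  [Fintype A] [Fintype B] {H K d : ℕ} {G : MarkovGame S A B}
  {φ : S × A × B → EuclideanSpace ℝ (Fin d)} {fold : Fin K → Fin H} {lam β : ℝ}
  {D : Fin K → Fin H → Sample S A B} {R : SPMVIRun S A B} {h : ℕ}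

namespace SPMVIRun

/-- A run all of whose regressions are accurate: the deterministic hypothesis under which its
estimates sandwich the values of the game. -/
structure IsGood (R : SPMVIRun S A B) (G : MarkovGame S A B)
    (φ : S × A × B → EuclideanSpace ℝ (Fin d)) (fold : Fin K → Fin H) (lam β : ℝ)
    (D : Fin K → Fin H → Sample S A B) : Prop where
  isRunOn : R.IsRunOn φ fold lam β D
  measurable_loV : ∀ h ≤ H, Measurable (R.loV h)
  measurable_upV : ∀ h ≤ H, Measurable (R.upV h)
  accurate_loV : ∀ h : Fin H, IsAccurate G φ fold lam β D h (R.loV (h + 1))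
  accurate_upV : ∀ h : Fin H, IsAccurate G φ fold lam β D h (R.upV (h + 1))

theorem IsRunOn.upV_mem_Icc (hR : R.IsRunOn φ fold lam β D) (hh : h ≤ H) (x : S) :
    R.upV h x ∈ Set.Icc 0 ((H : ℝ) - h) := by
  rw [hR.upV_eq_valueEstimate hh]
  exact valueEstimate_mem_Icc φ fold lam β D hh x

theorem IsRunOn.loV_mem_Icc (hR : R.IsRunOn φ fold lam β D) (hh : h ≤ H) (x : S) :
    R.loV h x ∈ Set.Icc 0 ((H : ℝ) - h) := by
  rw [hR.loV_eq_valueEstimate hh]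
  exact valueEstimate_mem_Icc φ fold lam (-β) D hh x

theorem IsRunOn.abs_value_sub_upV_le (hR : R.IsRunOn φ fold lam β D) (G : MarkovGame S A B)
    (π : Policy S A) (ν : Policy S B) (hh : h ≤ H) (x : S) :
    |G.value H π ν h x - R.upV h x| ≤ H := by
  have hvalue := G.value_mem_Icc H π ν h x
  have hest := hR.upV_mem_Icc hh x
  have hstep : (0 : ℝ) ≤ h := Nat.cast_nonneg h
  rw [abs_le]
  constructor <;> linarith [hvalue.1, hvalue.2, hest.1, hest.2, hstep]

theorem IsRunOn.abs_value_sub_loV_le (hR : R.IsRunOn φ fold lam β D) (G : MarkovGame S A B)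
    (π : Policy S A) (ν : Policy S B) (hh : h ≤ H) (x : S) :
    |G.value H π ν h x - R.loV h x| ≤ H := by
  have hvalue := G.value_mem_Icc H π ν h x
  have hest := hR.loV_mem_Icc hh x
  have hstep : (0 : ℝ) ≤ h := Nat.cast_nonneg h
  rw [abs_le]
  constructor <;> linarith [hvalue.1, hvalue.2, hest.1, hest.2, hstep]

namespace IsGood

theorem integrable_upV (hR : R.IsGood G φ fold lam β D) (hh : h < H) (z : S × A × B) :
    Integrable (R.upV (h + 1)) (G.P h z) :=
  Integrable.of_mem_Icc _ _ (hR.measurable_upV _ hh).aemeasurable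
    (ae_of_all _ fun x => hR.isRunOn.upV_mem_Icc hh x)

theorem integrable_loV (hR : R.IsGood G φ fold lam β D) (hh : h < H) (z : S × A × B) :
    Integrable (R.loV (h + 1)) (G.P h z) :=
  Integrable.of_mem_Icc _ _ (hR.measurable_loV _ hh).aemeasurable
    (ae_of_all _ fun x => hR.isRunOn.loV_mem_Icc hh x)

variable [MeasurableSingletonClass A] [MeasurableSingletonClass B]

theorem value_le_upV (hR : R.IsGood G φ fold lam β D) (π : Policy S A) (hh : h ≤ H) (x : S) :
    G.value H π R.νHat h x ≤ R.upV h x := by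
  rw [G.value_eq_expectedSum]
  refine G.expectedSum_le_of_payoff_le π R.νHat G.measurable_r G.abs_r_le
    (fun h hh z => hR.integrable_upV hh z) hR.isRunOn.upV_last (fun h hh x => ?_) hh x
  obtain ⟨-, hq, hmax, -⟩ := hR.isRunOn.upper_nash ⟨h, hh⟩ x
  rw [hR.isRunOn.upV_eq ⟨h, hh⟩ x]
  refine (payoff_mono (π.prob_mem_stdSimplex h x) hq fun a b => ?_).trans
    (hmax _ (π.prob_mem_stdSimplex h x))
  exact ((hR.accurate_upV ⟨h, hh⟩).upperQ_mem_Icc (hR.isRunOn.upV_mem_Icc hh) _).1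

theorem loV_le_value (hR : R.IsGood G φ fold lam β D) (ν : Policy S B) (hh : h ≤ H) (x : S) :
    R.loV h x ≤ G.value H R.πHat ν h x := by
  rw [G.value_eq_expectedSum]
  refine G.le_expectedSum_of_le_payoff R.πHat ν G.measurable_r G.abs_r_le
    (fun h hh z => hR.integrable_loV hh z) hR.isRunOn.loV_last (fun h hh x => ?_) hh x
  obtain ⟨hp, -, -, hmin⟩ := hR.isRunOn.lower_nash ⟨h, hh⟩ x
  rw [hR.isRunOn.loV_eq ⟨h, hh⟩ x]
  refine (hmin _ (ν.prob_mem_stdSimplex h x)).trans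
    (payoff_mono hp (ν.prob_mem_stdSimplex h x) fun a b => ?_)
  exact ((hR.accurate_loV ⟨h, hh⟩).lowerQ_mem_Icc (hR.isRunOn.loV_mem_Icc hh) _).2

theorem upV_le (hR : R.IsGood G φ fold lam β D) (hφ : Measurable φ) {M : ℝ} (hM₀ : 0 ≤ M)
    (hM : ∀ h z, matNorm (gram φ fold lam D h)⁻¹ (φ z) ≤ M) (ν : Policy S B) (hh : h ≤ H) (x : S) :
    R.upV h x ≤ G.value H R.πAux ν h x + 2 * β *
      G.expectedSum (R.πAux.joint ν) (featureNormSeq φ (gram φ fold lam D)) (H - h) h x := by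
  have hnorm := abs_featureNormSeq_le hM₀ hM
  have hmeas := measurable_featureNormSeq (Λ := gram φ fold lam D) hφ
  rw [G.value_eq_expectedSum, ← G.expectedSum_add_const_mul _ G.measurable_r G.abs_r_le hmeas hnorm]
  refine G.le_expectedSum_of_le_payoff R.πAux ν (M := 1 + |2 * β| * M)
    (g := fun h z => G.r h z + 2 * β * featureNormSeq φ (gram φ fold lam D) h z)
    (fun h => (G.measurable_r h).add ((hmeas h).const_mul _)) (fun h z => ?_)
    (fun h hh z => hR.integrable_upV hh z) hR.isRunOn.upV_last (fun h hh x => ?_) hh x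
  · refine (abs_add_le _ _).trans (add_le_add (G.abs_r_le h z) ?_)
    rw [abs_mul]
    exact mul_le_mul_of_nonneg_left (hnorm h z) (abs_nonneg _)
  · obtain ⟨hp, -, -, hmin⟩ := hR.isRunOn.upper_nash ⟨h, hh⟩ x
    rw [hR.isRunOn.upV_eq ⟨h, hh⟩ x]
    refine (hmin _ (ν.prob_mem_stdSimplex h x)).trans
      (payoff_mono hp (ν.prob_mem_stdSimplex h x) fun a b => ?_)
    have hQ := ((hR.accurate_upV ⟨h, hh⟩).upperQ_mem_Icc (hR.isRunOn.upV_mem_Icc hh) (x, a, b)).2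
    have hval : featureNormSeq φ (gram φ fold lam D) h (x, a, b) = _ :=
      featureNormSeq_val ⟨h, hh⟩ _
    rw [bonus, ← hval] at hQ
    linarith

theorem le_loV (hR : R.IsGood G φ fold lam β D) (hφ : Measurable φ) {M : ℝ} (hM₀ : 0 ≤ M)
    (hM : ∀ h z, matNorm (gram φ fold lam D h)⁻¹ (φ z) ≤ M) (π : Policy S A) (hh : h ≤ H) (x : S) :
    G.value H π R.νAux h x + -(2 * β) *
      G.expectedSum (π.joint R.νAux) (featureNormSeq φ (gram φ fold lam D)) (H - h) h x ≤
        R.loV h x := by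
  have hnorm := abs_featureNormSeq_le hM₀ hM
  have hmeas := measurable_featureNormSeq (Λ := gram φ fold lam D) hφ
  rw [G.value_eq_expectedSum, ← G.expectedSum_add_const_mul _ G.measurable_r G.abs_r_le hmeas hnorm]
  refine G.expectedSum_le_of_payoff_le π R.νAux (M := 1 + |-(2 * β)| * M)
    (g := fun h z => G.r h z + -(2 * β) * featureNormSeq φ (gram φ fold lam D) h z)
    (fun h => (G.measurable_r h).add ((hmeas h).const_mul _)) (fun h z => ?_)
    (fun h hh z => hR.integrable_loV hh z) hR.isRunOn.loV_last (fun h hh x => ?_) hh x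
  · refine (abs_add_le _ _).trans (add_le_add (G.abs_r_le h z) ?_)
    rw [abs_mul]
    exact mul_le_mul_of_nonneg_left (hnorm h z) (abs_nonneg _)
  · obtain ⟨-, hq, hmax, -⟩ := hR.isRunOn.lower_nash ⟨h, hh⟩ x
    rw [hR.isRunOn.loV_eq ⟨h, hh⟩ x]
    refine (payoff_mono (π.prob_mem_stdSimplex h x) hq fun a b => ?_).trans
      (hmax _ (π.prob_mem_stdSimplex h x))
    have hQ := ((hR.accurate_loV ⟨h, hh⟩).lowerQ_mem_Icc (hR.isRunOn.loV_mem_Icc hh) (x, a, b)).1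
    have hval : featureNormSeq φ (gram φ fold lam D) h (x, a, b) = _ :=
      featureNormSeq_val ⟨h, hh⟩ _
    rw [bonus, ← hval] at hQ
    linarith

theorem gap_le_upV_sub_loV (hR : R.IsGood G φ fold lam β D) (x : S) :
    G.gap H R.πHat R.νHat x ≤ R.upV 0 x - R.loV 0 x := by
  have : Nonempty (Policy S A) := ⟨R.πHat⟩
  have : Nonempty (Policy S B) := ⟨R.νHat⟩
  exact sub_le_sub (ciSup_le fun π => hR.value_le_upV π (Nat.zero_le _) x)
    (le_ciInf fun ν => hR.loV_le_value ν (Nat.zero_le _) x)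

variable {πStar : Policy S A} {νStar : Policy S B}

theorem nash_value_mem_Icc (hR : R.IsGood G φ fold lam β D) (hN : G.IsNash H πStar νStar)
    (hh : h < H) (x : S) : G.value H πStar νStar h x ∈ Set.Icc (R.loV h x) (R.upV h x) :=
  ⟨(hR.loV_le_value νStar hh.le x).trans ((hN h hh x).1 _),
    ((hN h hh x).2 _).trans (hR.value_le_upV πStar hh.le x)⟩

theorem gap_le (hR : R.IsGood G φ fold lam β D) (hφ : Measurable φ) (hβ : 0 ≤ β) {M : ℝ}
    (hM₀ : 0 ≤ M) (hM : ∀ h z, matNorm (gram φ fold lam D h)⁻¹ (φ z) ≤ M) (hH : 0 < H)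
    (hN : G.IsNash H πStar νStar) (x : S) :
    G.gap H R.πHat R.νHat x ≤ 2 * β *
      ((⨆ ν : Policy S B, G.uncertainty φ (gram φ fold lam D) πStar ν x) +
        ⨆ π : Policy S A, G.uncertainty φ (gram φ fold lam D) π νStar x) := by
  have hup := hR.upV_le hφ hM₀ hM νStar (Nat.zero_le _) x
  have hlo := hR.le_loV hφ hM₀ hM πStar (Nat.zero_le _) x
  rw [Nat.sub_zero, G.expectedSum_featureNormSeq hφ hM] at hup hlo
  have hsupν := le_ciSup (f := fun ν => G.uncertainty φ (gram φ fold lam D) πStar ν x)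
    ⟨H * M, Set.forall_mem_range.mpr fun ν => G.uncertainty_le hM πStar ν x⟩ R.νAux
  have hsupπ := le_ciSup (f := fun π => G.uncertainty φ (gram φ fold lam D) π νStar x)
    ⟨H * M, Set.forall_mem_range.mpr fun π => G.uncertainty_le hM π νStar x⟩ R.πAux
  refine le_trans ?_ (mul_le_mul_of_nonneg_left (add_le_add hsupν hsupπ)
    (mul_nonneg zero_le_two hβ))
  have hbestπ := (hN 0 hH x).1 R.πAux
  have hbestν := (hN 0 hH x).2 R.νAux
  linarith [hR.gap_le_upV_sub_loV x]

theorem abs_nash_value_sub_upV_le (hR : R.IsGood G φ fold lam β D) (hφ : Measurable φ)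
    (hβ : 0 ≤ β) {M : ℝ} (hM₀ : 0 ≤ M) (hM : ∀ h z, matNorm (gram φ fold lam D h)⁻¹ (φ z) ≤ M)
    (hN : G.IsNash H πStar νStar) (hh : h < H) (x : S) :
    |G.value H πStar νStar h x - R.upV h x| ≤ 2 * (H * (β * M)) := by
  rw [abs_sub_comm, abs_of_nonneg (sub_nonneg.mpr (hR.nash_value_mem_Icc hN hh x).2)]
  have hup := hR.upV_le hφ hM₀ hM νStar hh.le x
  have hsmall := G.mul_expectedSum_featureNormSeq_le hβ hM₀ hM (R.πAux.joint νStar) h x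
  linarith [(hN h hh x).1 R.πAux]

theorem abs_nash_value_sub_loV_le (hR : R.IsGood G φ fold lam β D) (hφ : Measurable φ)
    (hβ : 0 ≤ β) {M : ℝ} (hM₀ : 0 ≤ M) (hM : ∀ h z, matNorm (gram φ fold lam D h)⁻¹ (φ z) ≤ M)
    (hN : G.IsNash H πStar νStar) (hh : h < H) (x : S) :
    |G.value H πStar νStar h x - R.loV h x| ≤ 2 * (H * (β * M)) := by
  rw [abs_of_nonneg (sub_nonneg.mpr (hR.nash_value_mem_Icc hN hh x).1)]
  have hlo := hR.le_loV hφ hM₀ hM πStar hh.le x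
  have hsmall := G.mul_expectedSum_featureNormSeq_le hβ hM₀ hM (πStar.joint R.νAux) h x
  linarith [(hN h hh x).2 R.νAux]

end IsGood

end SPMVIRun

end Sandwich

section Constants

variable {d H K n : ℕ} {δ : ℝ}

theorem exp_logFactor (hd : 1 ≤ d) (hH : 1 ≤ H) (hK : 1 ≤ K) (hδ : 0 < δ) :
    Real.exp (logFactor d H K δ) = 2 * d * H * K / δ := by
  rw [logFactor, Real.exp_log]
  positivity

theorem two_mul_le_exp_logFactor (hd : 1 ≤ d) (hH : 1 ≤ H) (hK : 1 ≤ K) (hδ : 0 < δ)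
    (hδ1 : δ < 1) : 2 * (d * H * K : ℝ) ≤ Real.exp (logFactor d H K δ) := by
  rw [exp_logFactor hd hH hK hδ, ← mul_assoc, ← mul_assoc]
  exact le_div_self (by positivity) hδ hδ1.le

theorem two_le_exp_logFactor (hd : 1 ≤ d) (hH : 1 ≤ H) (hK : 1 ≤ K) (hδ : 0 < δ)
    (hδ1 : δ < 1) : 2 ≤ Real.exp (logFactor d H K δ) := by
  have hprod : (1 : ℝ) ≤ d * H * K := by exact_mod_cast Nat.mul_pos (Nat.mul_pos hd hH) hK
  linarith [two_mul_le_exp_logFactor hd hH hK hδ hδ1]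

theorem half_le_logFactor (hd : 1 ≤ d) (hH : 1 ≤ H) (hK : 1 ≤ K) (hδ : 0 < δ) (hδ1 : δ < 1) :
    1 / 2 ≤ logFactor d H K δ := by
  have hlog : Real.log 2 ≤ logFactor d H K δ :=
    (Real.log_le_iff_le_exp two_pos).mpr (two_le_exp_logFactor hd hH hK hδ hδ1)
  linarith [Real.log_two_gt_d9]

theorem half_le_sqrt_logFactor (hd : 1 ≤ d) (hH : 1 ≤ H) (hK : 1 ≤ K) (hδ : 0 < δ)
    (hδ1 : δ < 1) : 1 / 2 ≤ √(logFactor d H K δ) :=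
  Real.le_sqrt_of_sq_le (by linarith [half_le_logFactor hd hH hK hδ hδ1])

theorem bonus_multiplier_large (hd : 1 ≤ d) (hH : 1 ≤ H) (hK : 1 ≤ K) (hδ : 0 < δ) (hδ1 : δ < 1)
    {c : ℝ} (hc : 4 ≤ c) : √d * (2 * H * √(logFactor d H K δ)) + √1 * (√d * H) ≤
      c * √d * H * √(logFactor d H K δ) := by
  have hι := half_le_sqrt_logFactor hd hH hK hδ hδ1
  calc _ = √d * H * (2 * √(logFactor d H K δ) + 1) := by rw [Real.sqrt_one]; ring
    _ ≤ √d * H * (c * √(logFactor d H K δ)) := by gcongr; nlinarith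
    _ = c * √d * H * √(logFactor d H K δ) := by ring

theorem noise_failure_le (hd : 1 ≤ d) (hH : 1 ≤ H) (hK : 1 ≤ K) (hδ : 0 < δ) (hδ1 : δ < 1) :
    H * (2 * (d * (2 * Real.exp (-(2 * (2 * H * √(logFactor d H K δ)) ^ 2 / (H : ℝ) ^ 2))))) ≤
      δ / 2 := by
  have hι : 0 ≤ logFactor d H K δ := by linarith [half_le_logFactor hd hH hK hδ hδ1]
  have hexp : Real.exp (-(2 * (2 * H * √(logFactor d H K δ)) ^ 2 / (H : ℝ) ^ 2)) =
      (Real.exp (logFactor d H K δ) ^ 8)⁻¹ := by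
    rw [← Real.exp_nat_mul, ← Real.exp_neg, mul_pow, mul_pow, Real.sq_sqrt hι]
    congr 1
    push_cast
    field_simp
    ring
  have hexpδ : (2 * d * H : ℝ) ≤ Real.exp (logFactor d H K δ) * δ := by
    rw [exp_logFactor hd hH hK hδ, div_mul_cancel₀ _ hδ.ne']
    exact le_mul_of_one_le_right (by positivity) (by exact_mod_cast hK)
  have hpow : (128 : ℝ) ≤ Real.exp (logFactor d H K δ) ^ 7 := by
    calc (128 : ℝ) = 2 ^ 7 := by norm_num
      _ ≤ _ := by gcongr; exact two_le_exp_logFactor hd hH hK hδ hδ1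
  rw [hexp]
  generalize Real.exp (logFactor d H K δ) = y at hexpδ hpow
  have hy : y ≠ 0 := by rintro rfl; norm_num at hpow
  calc _ = (2 * d * H : ℝ) * 2 * (y ^ 8)⁻¹ := by ring
    _ ≤ (y * δ) * 2 * (y ^ 8)⁻¹ := by gcongr
    _ = 2 * δ * (y ^ 7)⁻¹ := by field_simp
    _ ≤ 2 * δ * (128 : ℝ)⁻¹ := by gcongr
    _ ≤ δ / 2 := by linarith

theorem covering_number_base_le (hd : 1 ≤ d) (hH : 1 ≤ H) (hK : 1 ≤ K) (hnK : n ≤ K) (hδ : 0 < δ)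
    (hδ1 : δ < 1) : (4 * d * n + 1 : ℝ) ≤ Real.exp (logFactor d H K δ) ^ 3 := by
  have hprod : (1 : ℝ) ≤ d * H * K := by exact_mod_cast Nat.mul_pos (Nat.mul_pos hd hH) hK
  have hdn : (d * n : ℝ) ≤ d * H * K := by
    exact_mod_cast Nat.mul_le_mul (Nat.le_mul_of_pos_right d hH) hnK
  have hexp := two_mul_le_exp_logFactor hd hH hK hδ hδ1
  have hsq : (2 : ℝ) ^ 2 ≤ Real.exp (logFactor d H K δ) ^ 2 := by
    gcongr; exact two_le_exp_logFactor hd hH hK hδ hδ1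
  calc (4 * d * n + 1 : ℝ) ≤ Real.exp (logFactor d H K δ) * 2 ^ 2 := by linarith
    _ ≤ Real.exp (logFactor d H K δ) * Real.exp (logFactor d H K δ) ^ 2 := by gcongr
    _ = _ := by ring

theorem coverage_failure_le (hd : 1 ≤ d) (hH : 1 ≤ H) (hK : 1 ≤ K) (hnK : n ≤ K) (hδ : 0 < δ)
    (hδ1 : δ < 1) {κ : ℝ} (hκ : 256 * d * logFactor d H K δ ≤ n * κ) :
    H * ((4 * d * n + 1) ^ d * Real.exp (-(n * κ / 64))) ≤ δ / 2 := by
  have hι : 0 ≤ logFactor d H K δ := by linarith [half_le_logFactor hd hH hK hδ hδ1]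
  have hd1 : (1 : ℝ) ≤ d := by exact_mod_cast hd
  have hK1 : (1 : ℝ) ≤ K := by exact_mod_cast hK
  have hbase := covering_number_base_le hd hH hK hnK hδ hδ1
  have hexpδ : (H : ℝ) ≤ Real.exp (logFactor d H K δ) * (δ / 2) := by
    rw [exp_logFactor hd hH hK hδ]
    calc (H : ℝ) ≤ H * (d * K) :=
          le_mul_of_one_le_right (Nat.cast_nonneg _) (one_le_mul_of_one_le_of_one_le hd1 hK1)
      _ = 2 * d * H * K / δ * (δ / 2) := by field_simp
  generalize logFactor d H K δ = ι at *
  calc _ ≤ (Real.exp ι * (δ / 2)) * ((Real.exp ι ^ 3) ^ d * Real.exp (-(4 * d * ι))) := by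
        gcongr
        linarith
    _ = δ / 2 * Real.exp (ι - d * ι) := by
        rw [show ι - d * ι = ι + ((3 * d : ℕ) * ι + -(4 * d * ι)) by push_cast; ring, Real.exp_add,
          Real.exp_add, Real.exp_nat_mul, pow_mul]
        ring
    _ ≤ δ / 2 * 1 := by
        gcongr
        exact Real.exp_le_one_iff.mpr (sub_nonpos.mpr (le_mul_of_one_le_left hι hd1))
    _ = δ / 2 := mul_one _

theorem rate_eq (hH : 1 ≤ H) (hnK : H * n = K) (κ : ℝ) :
    (H : ℝ) ^ (5 / 2 : ℝ) * √d / √(K * κ) = (H : ℝ) ^ 2 * √d / √(n * κ) := by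
  have hH0 : (0 : ℝ) < H := by exact_mod_cast hH
  have hpow : (H : ℝ) ^ (5 / 2 : ℝ) = √H * (H : ℝ) ^ 2 := by
    rw [Real.sqrt_eq_rpow, ← Real.rpow_natCast, ← Real.rpow_add hH0]
    norm_num
  rw [hpow, ← hnK, Nat.cast_mul, mul_assoc, mul_assoc (H : ℝ), Real.sqrt_mul hH0.le,
    mul_div_mul_left _ _ (Real.sqrt_pos.mpr hH0).ne']

theorem bonus_rate_le (hH : 1 ≤ H) (hnK : H * n = K) {κ c ι : ℝ} (hnκ : 0 < n * κ) (hc : 0 ≤ c) :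
    2 * (H * (c * √d * H * √ι * (1 / √(n * κ / 32)))) ≤
      (12 * c + 16) * √ι * ((H : ℝ) ^ (5 / 2 : ℝ) * √d / √(K * κ)) := by
  have hsqrt : √32 ≤ 6 := Real.sqrt_le_iff.mpr ⟨by norm_num, by norm_num⟩
  calc _ = (2 * c * √32) * (√ι * ((H : ℝ) ^ 2 * √d / √(n * κ))) := by
        rw [Real.sqrt_div hnκ.le]; field_simp
    _ ≤ (12 * c + 16) * (√ι * ((H : ℝ) ^ 2 * √d / √(n * κ))) := by gcongr; nlinarith
    _ = _ := by rw [rate_eq hH hnK]; ring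

theorem horizon_le_rate (hH : 1 ≤ H) (hnK : H * n = K) {κ c ι : ℝ} (hnκ : 0 < n * κ)
    (hc : 0 ≤ c) (hι : 0 ≤ ι) (hlt : n * κ < 256 * d * ι) :
    (H : ℝ) ≤ (12 * c + 16) * √ι * ((H : ℝ) ^ (5 / 2 : ℝ) * √d / √(K * κ)) := by
  have hH1 : (1 : ℝ) ≤ H := by exact_mod_cast hH
  have hsqrt : √(n * κ) ≤ 16 * √d * √ι := by
    refine Real.sqrt_le_iff.mpr ⟨by positivity, ?_⟩
    rw [mul_pow, mul_pow, Real.sq_sqrt (Nat.cast_nonneg _), Real.sq_sqrt hι]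
    linarith
  rw [rate_eq hH hnK, ← mul_div_assoc, le_div_iff₀ (Real.sqrt_pos.mpr hnκ)]
  calc H * √(n * κ) ≤ (H : ℝ) ^ 2 * (16 * √d * √ι) := by gcongr; exact le_self_pow₀ hH1 two_ne_zero
    _ = 16 * √ι * ((H : ℝ) ^ 2 * √d) := by ring
    _ ≤ _ := by gcongr; linarith

end Constants

section Probability

open Matrix hiding gram

variable {S A B : Type*} [MeasurableSpace S] [MeasurableSpace A] [MeasurableSpace B]
  {H K d : ℕ} {G : MarkovGame S A B} {φ : S × A × B → EuclideanSpace ℝ (Fin d)}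

theorem MarkovGame.IsLinear.one_le_dim (hG : G.IsLinear H φ) (hH : 1 ≤ H) (z : S × A × B) :
    1 ≤ d := by
  by_contra hd
  obtain rfl : d = 0 := by omega
  obtain ⟨μ, hμ, -⟩ := hG.transition 0 hH
  have hmass := hμ z Set.univ MeasurableSet.univ
  rw [probReal_univ, Subsingleton.elim (φ z) 0, inner_zero_left] at hmass
  exact one_ne_zero hmass

theorem MarkovGame.IsLinear.one_le_dim_of_isProbabilityMeasure (hG : G.IsLinear H φ) (hH : 1 ≤ H)
    (ρ : Measure S) [IsProbabilityMeasure ρ] (b : Policy S (A × B)) : 1 ≤ d := by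
  obtain ⟨x⟩ := nonempty_of_isProbabilityMeasure ρ
  obtain ⟨z⟩ := nonempty_of_isProbabilityMeasure (b.kernel 0 x)
  exact hG.one_le_dim hH (x, z)

theorem measure_iUnion_fin_le_ofReal {Ω : Type*} [MeasurableSpace Ω] {μ : Measure Ω}
    {s : Fin H → Set Ω} {r : ℝ} (hs : ∀ h, μ (s h) ≤ ENNReal.ofReal r) :
    μ (⋃ h, s h) ≤ ENNReal.ofReal (H * r) := by
  calc μ (⋃ h, s h) ≤ ∑ h, μ (s h) := measure_iUnion_fintype_le _ _
    _ ≤ ∑ _h : Fin H, ENNReal.ofReal r := Finset.sum_le_sum fun h _ => hs h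
    _ = ENNReal.ofReal (H * r) := by
      rw [Finset.sum_const, Finset.card_univ, Fintype.card_fin, nsmul_eq_mul,
        ENNReal.ofReal_mul (Nat.cast_nonneg _), ENNReal.ofReal_natCast]

theorem MarkovGame.measure_exists_gram_lt_le (G : MarkovGame S A B) (ρ : Measure S)
    [IsProbabilityMeasure ρ] (b : Policy S (A × B)) (hφ : Measurable φ) (hφ1 : ∀ z, ‖φ z‖ ≤ 1)
    (fold : Fin K → Fin H) {lam : ℝ} (hlam : 1 / 4 ≤ lam) {n : ℕ}
    (hn : ∀ h, (Finset.univ.filter fun τ => fold τ = h).card = n) (hn0 : 0 < n)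
    (hκ : 0 ≤ G.coverage ρ b H φ) :
    G.dataLaw ρ b H K {ω | ∃ (h : Fin H) (v : Fin d → ℝ),
        v ⬝ᵥ gram φ fold lam (G.observe ω) h *ᵥ v <
          n * G.coverage ρ b H φ / 32 * (v ⬝ᵥ v)} ≤
      ENNReal.ofReal (H * ((4 * d * n + 1) ^ d *
        Real.exp (-(n * G.coverage ρ b H φ / 64)))) := by
  rw [Set.ofPred_exists]
  exact measure_iUnion_fin_le_ofReal fun h =>
    G.measure_gram_lt_le ρ b hφ hφ1 fold h hlam (hn h) hn0 hκ le_rfl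

variable [Fintype A] [Fintype B]

/-- The noise of the regression of step `h`, when the estimate of the next value function is
computed with the bonus multiplier `β`. -/
def MarkovGame.estimateNoise (G : MarkovGame S A B) (φ : S × A × B → EuclideanSpace ℝ (Fin d))
    (fold : Fin K → Fin H) (lam β : ℝ) (ω : Fin K → Fin H → Transition S A B) (h : Fin H) :
    EuclideanSpace ℝ (Fin d) :=
  transitionNoise (G.P h) φ {τ | fold τ = h}
    (valueEstimate φ fold lam β (G.observe ω) (h + 1)) fun τ => ω τ h

theorem MarkovGame.measure_estimateNoise_le (G : MarkovGame S A B) (ρ : Measure S)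
    [IsProbabilityMeasure ρ] (b : Policy S (A × B)) (hφ : Measurable φ) (fold : Fin K → Fin H)
    {lam : ℝ} (hlam : 0 < lam) (β : ℝ) {t : ℝ} (ht : 0 ≤ t) (h : Fin H) :
    G.dataLaw ρ b H K {ω | √d * t < matNorm (gram φ fold lam (G.observe ω) h)⁻¹
        (G.estimateNoise φ fold lam β ω h)} ≤
      ENNReal.ofReal (d * (2 * Real.exp (-(2 * t ^ 2 / (H : ℝ) ^ 2)))) := by
  rw [← sub_zero (H : ℝ)]
  refine G.measure_transitionNoise_le ρ b hφ fold h hlam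
    (measurable_valueEstimate G hφ fold lam β h.2) (fun ω ω' hω => ?_) (fun ω x => ?_) ht
  · exact valueEstimate_congr φ lam β h.2 fun τ hτ =>
      congrArg (fun ω => G.observe (fun _ => ω) τ) (hω τ fun heq => by omega)
  · exact Set.Icc_subset_Icc_right (sub_le_self _ (Nat.cast_nonneg _))
      (valueEstimate_mem_Icc φ fold lam β _ h.2 x)

theorem SPMVIRun.IsRunOn.isGood {fold : Fin K → Fin H} {lam β : ℝ}
    {ω : Fin K → Fin H → Transition S A B} {R : SPMVIRun S A B}
    (hR : R.IsRunOn φ fold lam β (G.observe ω)) (hG : G.IsLinear H φ) (hlam : 0 < lam) {t : ℝ}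
    (hlo : ∀ h, matNorm (gram φ fold lam (G.observe ω) h)⁻¹
      (G.estimateNoise φ fold lam (-β) ω h) ≤ t)
    (hup : ∀ h, matNorm (gram φ fold lam (G.observe ω) h)⁻¹
      (G.estimateNoise φ fold lam β ω h) ≤ t)
    (hβ : t + √lam * (√d * H) ≤ β) : R.IsGood G φ fold lam β (G.observe ω) := by
  have hmeas : ∀ β, ∀ h ≤ H, Measurable (valueEstimate φ fold lam β (G.observe ω) h) :=
    fun β h hh => (measurable_valueEstimate G hG.measurable fold lam β hh).comp
      measurable_prodMk_left
  have hacc : ∀ β', (∀ h, matNorm (gram φ fold lam (G.observe ω) h)⁻¹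
      (G.estimateNoise φ fold lam β' ω h) ≤ t) → ∀ h : Fin H, IsAccurate G φ fold lam β
        (G.observe ω) h (valueEstimate φ fold lam β' (G.observe ω) (h + 1)) :=
    fun β' hnoise h => hG.isAccurate fold hlam h (hmeas β' _ h.2)
      (valueEstimate_mem_Icc φ fold lam β' _ h.2) ω (hnoise h) hβ
  refine ⟨hR, fun h hh => ?_, fun h hh => ?_, fun h => ?_, fun h => ?_⟩
  · exact hR.loV_eq_valueEstimate hh ▸ hmeas _ h hh
  · exact hR.upV_eq_valueEstimate hh ▸ hmeas _ h hh
  · exact hR.loV_eq_valueEstimate h.2 ▸ hacc _ hlo h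
  · exact hR.upV_eq_valueEstimate h.2 ▸ hacc _ hup h

theorem MarkovGame.IsLinear.measure_exists_not_isGood_le (hG : G.IsLinear H φ) (ρ : Measure S)
    [IsProbabilityMeasure ρ] (b : Policy S (A × B)) (fold : Fin K → Fin H) {lam β t : ℝ}
    (hlam : 0 < lam) (ht : 0 ≤ t) (hβ : √d * t + √lam * (√d * H) ≤ β) :
    G.dataLaw ρ b H K {ω | ∃ R : SPMVIRun S A B, R.IsRunOn φ fold lam β (G.observe ω) ∧
        ¬ R.IsGood G φ fold lam β (G.observe ω)} ≤
      ENNReal.ofReal (H * (2 * (d * (2 * Real.exp (-(2 * t ^ 2 / (H : ℝ) ^ 2)))))) := by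
  set noisy : ℝ → Fin H → Set (Fin K → Fin H → Transition S A B) := fun β h =>
    {ω | √d * t < matNorm (gram φ fold lam (G.observe ω) h)⁻¹
      (G.estimateNoise φ fold lam β ω h)} with hnoisy
  have hsub : {ω | ∃ R : SPMVIRun S A B, R.IsRunOn φ fold lam β (G.observe ω) ∧
      ¬ R.IsGood G φ fold lam β (G.observe ω)} ⊆ ⋃ h, (noisy (-β) h ∪ noisy β h) := by
    rintro ω ⟨R, hR, hbad⟩
    by_contra hω
    simp only [Set.mem_iUnion, Set.mem_union, not_exists, not_or, hnoisy, Set.mem_ofPred_eq,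
      not_lt] at hω
    exact hbad (hR.isGood hG hlam (fun h => (hω h).1) (fun h => (hω h).2) hβ)
  refine (measure_mono hsub).trans (measure_iUnion_fin_le_ofReal fun h => ?_)
  have hnoise := fun β => G.measure_estimateNoise_le ρ b hG.measurable fold hlam β ht h
  rw [two_mul, ENNReal.ofReal_add (by positivity) (by positivity)]
  exact (measure_union_le _ _).trans (add_le_add (hnoise _) (hnoise _))

end Probability

section Rates

open Matrix hiding gram

variable {S A B : Type*} [MeasurableSpace S] [Fintype A] [MeasurableSpace A]
  [MeasurableSingletonClass A] [Fintype B] [MeasurableSpace B] [MeasurableSingletonClass B]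
  {H K d n : ℕ} {G : MarkovGame S A B} {φ : S × A × B → EuclideanSpace ℝ (Fin d)}
  {fold : Fin K → Fin H} {c ι κ : ℝ} {D : Fin K → Fin H → Sample S A B} {R : SPMVIRun S A B}
  {πStar : Policy S A} {νStar : Policy S B}

namespace SPMVIRun.IsGood

theorem gap_le_rate (hR : R.IsGood G φ fold 1 (c * √d * H * √ι) D) (hφ : Measurable φ)
    (hφ1 : ∀ z, ‖φ z‖ ≤ 1) (hc : 0 ≤ c) (hH : 0 < H) (hN : G.IsNash H πStar νStar) (x : S) :
    G.gap H R.πHat R.νHat x ≤ (12 * c + 16) * √d * H * √ι *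
      ((⨆ ν : Policy S B, G.uncertainty φ (gram φ fold 1 D) πStar ν x) +
        ⨆ π : Policy S A, G.uncertainty φ (gram φ fold 1 D) π νStar x) := by
  refine (hR.gap_le hφ (by positivity) (by positivity)
    (matNorm_gram_inv_le hφ1 fold one_pos D) hH hN x).trans (mul_le_mul_of_nonneg_right ?_ ?_)
  · calc 2 * (c * √d * H * √ι) = 2 * c * √d * H * √ι := by ring
      _ ≤ (12 * c + 16) * √d * H * √ι := by gcongr; linarith
  · exact add_nonneg (Real.iSup_nonneg fun ν => G.uncertainty_nonneg _ ν x)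
      (Real.iSup_nonneg fun π => G.uncertainty_nonneg π _ x)

theorem abs_nash_value_sub_le_rate (hR : R.IsGood G φ fold 1 (c * √d * H * √ι) D)
    (hφ : Measurable φ) (hφ1 : ∀ z, ‖φ z‖ ≤ 1) (hc : 0 ≤ c) (hι : 0 ≤ ι)
    (hN : G.IsNash H πStar νStar) (hnK : H * n = K) (hnκ : 0 < n * κ)
    (hL : 256 * d * ι ≤ n * κ → ∀ (h : Fin H) (v : Fin d → ℝ),
      n * κ / 32 * (v ⬝ᵥ v) ≤ v ⬝ᵥ gram φ fold 1 D h *ᵥ v) {h : ℕ} (hh : h < H) (x : S) :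
    |G.value H πStar νStar h x - R.upV h x| ≤
        (12 * c + 16) * √ι * ((H : ℝ) ^ (5 / 2 : ℝ) * √d / √(K * κ)) ∧
      |G.value H πStar νStar h x - R.loV h x| ≤
        (12 * c + 16) * √ι * ((H : ℝ) ^ (5 / 2 : ℝ) * √d / √(K * κ)) := by
  have hH : 1 ≤ H := by omega
  rcases le_or_gt (256 * d * ι) (n * κ) with hlarge | hsmall
  · have hβ : 0 ≤ c * √d * H * √ι := by positivity
    have hM : ∀ h z, matNorm (gram φ fold 1 D h)⁻¹ (φ z) ≤ 1 / √(n * κ / 32) := fun h =>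
      matNorm_gram_inv_le_of_le hφ1 one_pos (by positivity) (hL hlarge h)
    have hrate := bonus_rate_le (d := d) (ι := ι) hH hnK hnκ hc
    exact ⟨(hR.abs_nash_value_sub_upV_le hφ hβ (by positivity) hM hN hh x).trans hrate,
      (hR.abs_nash_value_sub_loV_le hφ hβ (by positivity) hM hN hh x).trans hrate⟩
  · have hrate := horizon_le_rate hH hnK hnκ hc hι hsmall
    exact ⟨(hR.isRunOn.abs_value_sub_upV_le G πStar νStar hh.le x).trans hrate,
      (hR.isRunOn.abs_value_sub_loV_le G πStar νStar hh.le x).trans hrate⟩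

end SPMVIRun.IsGood

end Rates

section FailureProbability

open Matrix hiding gram

variable {S A B : Type*} [MeasurableSpace S] [MeasurableSpace A] [MeasurableSpace B]
  {H K d n : ℕ} {δ : ℝ} {G : MarkovGame S A B} {φ : S × A × B → EuclideanSpace ℝ (Fin d)}
  {fold : Fin K → Fin H}

namespace MarkovGame.IsLinear

theorem measure_coverage_failure_le (hG : G.IsLinear H φ) (ρ : Measure S) [IsProbabilityMeasure ρ]
    (b : Policy S (A × B)) (hH : 1 ≤ H) (hK : 1 ≤ K) (hnK : H * n = K)
    (hn : ∀ h, (Finset.univ.filter fun τ => fold τ = h).card = n) (hδ : 0 < δ) (hδ1 : δ < 1)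
    (hlarge : 256 * d * logFactor d H K δ ≤ n * G.coverage ρ b H φ) :
    G.dataLaw ρ b H K {ω | ∃ (h : Fin H) (v : Fin d → ℝ),
        v ⬝ᵥ gram φ fold 1 (G.observe ω) h *ᵥ v <
          n * G.coverage ρ b H φ / 32 * (v ⬝ᵥ v)} ≤ ENNReal.ofReal (δ / 2) := by
  have hd := hG.one_le_dim_of_isProbabilityMeasure hH ρ b
  have hn0 : 0 < n := Nat.pos_of_mul_pos_left (hnK ▸ hK)
  have hκ : 0 ≤ G.coverage ρ b H φ := by
    have hι := half_le_logFactor hd hH hK hδ hδ1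
    exact nonneg_of_mul_nonneg_right (le_trans (by positivity) hlarge) (Nat.cast_pos.mpr hn0)
  exact (G.measure_exists_gram_lt_le ρ b hG.measurable hG.norm_le fold (by norm_num) hn hn0
    hκ).trans (ENNReal.ofReal_le_ofReal
      (coverage_failure_le hd hH hK (hnK ▸ Nat.le_mul_of_pos_left n hH) hδ hδ1 hlarge))

variable [Fintype A] [Fintype B]

theorem measure_noise_failure_le (hG : G.IsLinear H φ) (ρ : Measure S) [IsProbabilityMeasure ρ]
    (b : Policy S (A × B)) (fold : Fin K → Fin H) (hH : 1 ≤ H) (hK : 1 ≤ K) (hδ : 0 < δ)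
    (hδ1 : δ < 1) {c : ℝ} (hc : 4 ≤ c) :
    G.dataLaw ρ b H K {ω | ∃ R : SPMVIRun S A B,
        R.IsRunOn φ fold 1 (c * √d * H * √(logFactor d H K δ)) (G.observe ω) ∧
        ¬ R.IsGood G φ fold 1 (c * √d * H * √(logFactor d H K δ)) (G.observe ω)} ≤
      ENNReal.ofReal (δ / 2) :=
  have hd := hG.one_le_dim_of_isProbabilityMeasure hH ρ b
  (hG.measure_exists_not_isGood_le ρ b fold one_pos (by positivity)
    (bonus_multiplier_large hd hH hK hδ hδ1 hc)).trans
      (ENNReal.ofReal_le_ofReal (noise_failure_le hd hH hK hδ hδ1))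

theorem measure_failure_le (hG : G.IsLinear H φ) (ρ : Measure S) [IsProbabilityMeasure ρ]
    (b : Policy S (A × B)) (hH : 1 ≤ H) (hK : 1 ≤ K) (hnK : H * n = K)
    (hn : ∀ h, (Finset.univ.filter fun τ => fold τ = h).card = n) (hδ : 0 < δ) (hδ1 : δ < 1)
    {c : ℝ} (hc : 4 ≤ c) :
    G.dataLaw ρ b H K {ω | ¬ ((∀ R : SPMVIRun S A B,
        R.IsRunOn φ fold 1 (c * √d * H * √(logFactor d H K δ)) (G.observe ω) →
          R.IsGood G φ fold 1 (c * √d * H * √(logFactor d H K δ)) (G.observe ω)) ∧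
        (256 * d * logFactor d H K δ ≤ n * G.coverage ρ b H φ → ∀ (h : Fin H) (v : Fin d → ℝ),
          n * G.coverage ρ b H φ / 32 * (v ⬝ᵥ v) ≤
            v ⬝ᵥ gram φ fold 1 (G.observe ω) h *ᵥ v))} ≤ ENNReal.ofReal δ := by
  have hnoise := hG.measure_noise_failure_le ρ b fold hH hK hδ hδ1 hc
  simp only [not_and_or, not_forall, exists_prop, not_le, Set.ofPred_or]
  rw [← add_halves δ, ENNReal.ofReal_add (by positivity) (by positivity), add_halves δ]
  refine (measure_union_le _ _).trans (add_le_add hnoise ?_)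
  by_cases hlarge : 256 * d * logFactor d H K δ ≤ n * G.coverage ρ b H φ
  · simpa only [hlarge, true_and] using
      hG.measure_coverage_failure_le ρ b hH hK hnK hn hδ hδ1 hlarge
  · simp [hlarge]

end MarkovGame.IsLinear

end FailureProbability

end

theorem mainTheorem6 :
    ∃ c₀ : ℝ, 0 < c₀ ∧ ∀ c : ℝ, c₀ ≤ c → ∃ C : ℝ, 0 < C ∧
      ∀ (S : Type*) (A : Type*) (B : Type*) [MeasurableSpace S]
        [Fintype A] [MeasurableSpace A] [MeasurableSingletonClass A]
        [Fintype B] [MeasurableSpace B] [MeasurableSingletonClass B]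
        (d H K : ℕ) (G : MarkovGame S A B) (φ : S × A × B → EuclideanSpace ℝ (Fin d))
        (ρ : Measure S) [IsProbabilityMeasure ρ] (b : Policy S (A × B))
        (fold : Fin K → Fin H) (δ : ℝ) (πStar : Policy S A) (νStar : Policy S B),
        1 ≤ H → 1 ≤ K →
        (∀ h : Fin H, H * (Finset.univ.filter fun τ => fold τ = h).card = K) →
        0 < δ → δ < 1 →
        G.IsLinear H φ →
        G.IsNash H πStar νStar →
        G.dataLaw ρ b H K
          {ω | ¬ ∀ R : SPMVIRun S A B,
            R.IsRunOn φ fold 1 (c * √d * H * √(logFactor d H K δ)) (G.observe ω) →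
            (∀ x : S, G.gap H R.πHat R.νHat x ≤
              C * √d * H * √(logFactor d H K δ) *
                ((⨆ ν : Policy S B,
                    G.uncertainty φ (gram φ fold 1 (G.observe ω)) πStar ν x) +
                 (⨆ π : Policy S A,
                    G.uncertainty φ (gram φ fold 1 (G.observe ω)) π νStar x))) ∧
            (0 < G.coverage ρ b H φ →
              ∀ h < H, ∀ x : S,
                |G.value H πStar νStar h x - R.upV h x| ≤
                  C * √(logFactor d H K δ) *
                    ((H : ℝ) ^ (5 / 2 : ℝ) * √d / √(K * G.coverage ρ b H φ)) ∧
                |G.value H πStar νStar h x - R.loV h x| ≤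
                  C * √(logFactor d H K δ) *
                    ((H : ℝ) ^ (5 / 2 : ℝ) * √d / √(K * G.coverage ρ b H φ)))}
          ≤ ENNReal.ofReal δ := by
  refine ⟨4, by norm_num, fun c hc => ⟨12 * c + 16, by linarith, ?_⟩⟩
  intro S A B _ _ _ _ _ _ _ d H K G φ ρ _ b fold δ πStar νStar hH hK hfold hδ hδ1 hG hN
  obtain ⟨n, hnK⟩ : ∃ n, H * n = K := ⟨_, hfold ⟨0, hH⟩⟩
  have hn : ∀ h : Fin H, (Finset.univ.filter fun τ => fold τ = h).card = n := fun h =>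
    Nat.eq_of_mul_eq_mul_left hH ((hfold h).trans hnK.symm)
  have hn0 : (0 : ℝ) < n := Nat.cast_pos.mpr (Nat.pos_of_mul_pos_left (hnK ▸ hK))
  have hd := hG.one_le_dim_of_isProbabilityMeasure hH ρ b
  have hι : 0 ≤ logFactor d H K δ := by linarith [half_le_logFactor hd hH hK hδ hδ1]
  have hc0 : 0 ≤ c := by linarith
  refine (measure_mono ?_).trans (hG.measure_failure_le ρ b hH hK hnK hn hδ hδ1 hc)
  refine fun ω hω ⟨hruns, hcov⟩ => hω fun R hR => ?_
  exact ⟨(hruns R hR).gap_le_rate hG.measurable hG.norm_le hc0 hH hN, fun hκ h hh x =>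
    (hruns R hR).abs_nash_value_sub_le_rate hG.measurable hG.norm_le hc0 hι hN hnK
      (mul_pos hn0 hκ) hcov hh x⟩
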